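/- **Definitions.** A *configuration of $n$ skew lines* is a set of $n$ lines in $\mathbb R^3$, no two of which intersect and no two of which are parallel. Two such configurations are *isotopic* if one can be continuously deformed into the other through configurations of $n$ skew lines (the deformation need not respect any labelling of the lines). For oriented skew lines $A\ni A_\alpha,A_\omega$ and $B\ni B_\alpha,B_\omega$, oriented from the first to the second point, let $\mathrm{lk}(A,B)\in\{\pm1\}$ be the sign of the determinant with rows $A_\omega-A_\alpha,\ B_\alpha-A_\omega,\ B_\omega-B_\alpha$. A *spindle* is a skew configuration all of whose lines meet an oriented line $A$ (the *axis*). Let $L_1<\dots<L_n$ be its lines in the order in which they meet $A$, and let $\Pi_i$ be the plane spanned by $A$ and $L_i$. Let $B$ be an oriented line with $\mathrm{lk}(A,B)=-1$ that meets each $\Pi_i$ in exactly one point (a *directrix*). The points $B\cap\Pi_i$ are then distinct, and $\sigma(i)$ is defined as the rank of $B\cap\Pi_i$ among them in the order along $B$. The permutation $\sigma$ of $\{1,\dots,n\}$ is called a *spindle-permutation* of the spindle. A skew configuration isotopic to a spindle with spindle-permutation $\sigma$ is called a *spindle-configuration described by* $\sigma$. *Spindle-equivalence* is the equivalence relation on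 permutations of $\{1,\dots,n\}$ generated by 1. (circular moves) $\sigma\sim\mu$ if, for some integers $0\le s,t<n$, $\mu(i)\equiv s+\sigma(i+t)\pmod n$ for all $i$, where the argument $i+t$ is also read modulo $n$; 2. (vertical reflections of a block) $\sigma\sim\mu$ if, for some $k\le n$, $\sigma(\{1,\dots,k\})=\{1,\dots,k\}$, $\mu(i)=k+1-\sigma(k+1-i)$ for $i\le k$ and $\mu(i)=\sigma(i)$ for $i>k$; 3. (horizontal reflections, or local inversions, of a block) $\sigma\sim\mu$ if, for some $k\le n$, $\sigma(\{1,\dots,k\})=\{1,\dots,k\}$, $\mu(i)=\sigma^{-1}(i)$ for $i\le k$ and $\mu(i)=\sigma(i)$ for $i>k$. **Theorem 1.1.** Let $n\ge 0$. Every permutation of $\{1,\dots,n\}$ is a spindle-permutation of some spindle. If $C$ and $C'$ are spindle-configurations described by permutations $\sigma$ and $\sigma'$ of $\{1,\dots,n\}$, respectively, then $C$ and $C'$ are isotopic if and only if $\sigma$ and $\sigma'$ are spindle-equivalent. -/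

import Mathlib

/-- The real affine space `ℝ³` (no norm is used). -/
abbrev R3 : Type := Fin 3 → ℝ

/-- The line through `p` with direction `d` (a genuine line exactly when `d ≠ 0`). -/
def lineThrough (p d : R3) : AffineSubspace ℝ R3 :=
  AffineSubspace.mk' p (Submodule.span ℝ {d})

/-- `L` is an affine line of `ℝ³`. -/
def IsLine (L : AffineSubspace ℝ R3) : Prop :=
  ∃ p d : R3, d ≠ 0 ∧ L = lineThrough p d

/-- A configuration of `n` skew lines: a set of `n` lines in `ℝ³`, no two of which
intersect and no two of which are parallel. -/
@[ext]
structure SkewConfiguration (n : ℕ) where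
  lines : Set (AffineSubspace ℝ R3)
  card_eq : lines.encard = n
  isLine : ∀ L ∈ lines, IsLine L
  disjoint : ∀ L ∈ lines, ∀ M ∈ lines, L ≠ M → Disjoint (L : Set R3) (M : Set R3)
  not_parallel : ∀ L ∈ lines, ∀ M ∈ lines, L ≠ M → ¬ L.Parallel M

/-- A family of skew configurations over the unit interval is continuous if its lines can be
followed continuously: they are the lines through points `p i t` with directions `d i t`, all
depending continuously on `t`. (As `Γ t` consists of `n` lines, the `d i t` are nonzero and the
`n` lines are distinct for every `t`.) -/
def IsContinuousDeformation {n : ℕ} (Γ : unitInterval → SkewConfiguration n) : Prop :=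
  ∃ p d : Fin n → unitInterval → R3,
    (∀ i, Continuous (p i)) ∧ (∀ i, Continuous (d i)) ∧
      ∀ t, (Γ t).lines = Set.range fun i => lineThrough (p i t) (d i t)

/-- Isotopy of skew configurations: a continuous deformation through skew configurations. -/
def Isotopic {n : ℕ} (C C' : SkewConfiguration n) : Prop :=
  ∃ Γ : unitInterval → SkewConfiguration n, IsContinuousDeformation Γ ∧ Γ 0 = C ∧ Γ 1 = C'

/-- An oriented line, given by an ordered pair of distinct points `α`, `ω` on it; the
orientation goes from `α` to `ω`. -/
structure OrientedLine where
  α : R3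
  ω : R3
  ne : α ≠ ω

namespace OrientedLine

/-- The underlying line. -/
def toLine (A : OrientedLine) : AffineSubspace ℝ R3 := lineThrough A.α (A.ω - A.α)

/-- The point with parameter `s`; the parameter increases along the orientation. -/
def point (A : OrientedLine) (s : ℝ) : R3 := A.α + s • (A.ω - A.α)

/-- The sign of the crossing (linking number) of two oriented lines; it vanishes exactly when
the lines are coplanar. -/
noncomputable def lk (A B : OrientedLine) : SignType :=
  SignType.sign (Matrix.det (Matrix.of ![A.ω - A.α, B.α - A.ω, B.ω - B.α]))

end OrientedLine

/-- The skew configuration `C` is a spindle with spindle-permutation `σ` for some choice of an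
oriented axis `A` and a directrix `B`:
* `A` meets all lines, which are enumerated as `L 0, L 1, …` in their order along `A`;
* `B` is an oriented line crossing `A` negatively and meeting the plane `Π i` spanned by `A` and
  `L i` in exactly one point, namely `B.point (y i)`;
* `σ` compares the points `B ∩ Π i` in their order along `B`. -/
def IsSpindleWith {n : ℕ} (C : SkewConfiguration n) (σ : Equiv.Perm (Fin n)) : Prop :=
  ∃ (A B : OrientedLine) (L : Fin n → AffineSubspace ℝ R3) (x y : Fin n → ℝ),
    C.lines = Set.range L ∧
    StrictMono x ∧ (∀ i, A.point (x i) ∈ L i) ∧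
    A.lk B = -1 ∧ (∀ i s, B.point s ∈ L i ⊔ A.toLine ↔ s = y i) ∧
    ∀ i j, σ i < σ j ↔ y i < y j

/-- `C` is a spindle-configuration described by the spindle-permutation `σ`: it is isotopic to a
spindle with spindle-permutation `σ`. -/
def IsSpindleConfigurationWith {n : ℕ} (C : SkewConfiguration n) (σ : Equiv.Perm (Fin n)) :
    Prop :=
  ∃ S : SkewConfiguration n, IsSpindleWith S σ ∧ Isotopic C S

/-- Circular move: `μ(i) = s + σ(i + t)`, everything modulo `n`.
(Numbering from `0` or from `1` gives the same relation.) -/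
def CircularMove {n : ℕ} (σ μ : Equiv.Perm (Fin n)) : Prop :=
  ∃ s t : ℕ, s < n ∧ t < n ∧
    ∀ i j : Fin n, (j : ℕ) ≡ i + t [MOD n] → (μ i : ℕ) ≡ s + σ j [MOD n]

/-- Vertical reflection of the block formed by the first `k` elements. With elements numbered
from `1` this reads `μ(i) = k + 1 - σ(k + 1 - i)` for `i ≤ k` and `μ(i) = σ(i)` for `i > k`;
below the elements are numbered from `0`. -/
def VerticalReflection {n : ℕ} (σ μ : Equiv.Perm (Fin n)) : Prop :=
  ∃ k : ℕ, k ≤ n ∧ (∀ i : Fin n, (i : ℕ) < k → (σ i : ℕ) < k) ∧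
    (∀ i j : Fin n, (i : ℕ) + j + 1 = k → (μ i : ℕ) + σ j + 1 = k) ∧
    ∀ i : Fin n, k ≤ (i : ℕ) → μ i = σ i

/-- Horizontal reflection (local inversion) of the block formed by the first `k` elements:
`μ(i) = σ⁻¹(i)` on the block and `μ(i) = σ(i)` outside. -/
def HorizontalReflection {n : ℕ} (σ μ : Equiv.Perm (Fin n)) : Prop :=
  ∃ k : ℕ, k ≤ n ∧ (∀ i : Fin n, (i : ℕ) < k → (σ i : ℕ) < k) ∧
    (∀ i : Fin n, (i : ℕ) < k → μ i = σ⁻¹ i) ∧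
    ∀ i : Fin n, k ≤ (i : ℕ) → μ i = σ i

/-- Spindle-equivalence: the equivalence relation generated by the three moves. -/
def SpindleEquivalent {n : ℕ} : Equiv.Perm (Fin n) → Equiv.Perm (Fin n) → Prop :=
  Relation.EqvGen fun σ μ =>
    CircularMove σ μ ∨ VerticalReflection σ μ ∨ HorizontalReflection σ μ

/-! Lines through p, q with nonzero directions d, e are skew exactly when the determinant of d, e, p
- q is nonzero. Along an isotopy these determinants keep their signs, and replacing each direction d
i by l i • d i multiplies them by l i * l j. Hence the pairwise linking signs, up to relabelling and
switching, are an isotopy invariant (`Isotopic.exists_switching`).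

Every spindle deforms to a normal form: lines through (x i, 0, 0) with direction (0, y i, 1), where
only the orders of the x i and of the y i matter (`IsSpindleWith.isotopic`). This replaces a
spindle-configuration described by σ by `permConfig 1 σ`, and the linking sign of lines i, j becomes
the sign of (i - j)(σ i - σ j). It records whether the pair is an inversion.

Equivalent permutations give isotopic spindles because each move is a motion of normal forms.
Turning all directions about the axis shifts the slopes cyclically. A block can be shrunk until it
stays clear of the other lines, then turned by a half-turn about the z-axis (vertical reflection) or
moved so that positions and slopes are exchanged (horizontal reflection, which also transfers cyclic
shifts from slopes to positions).

Conversely, isotopic spindles have inversion graphs that agree after relabelling and switching.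
Circular moves put one chosen label first in all four orders; this makes the switching trivial and
the inversion graphs equal (`pairEquivalent_of_switching`). It remains to see that block moves
connect two pairs of linear orders with the same inversion graph (`canMatch`). This is Gallai's
theory of transitive orientations, done by induction on blocks, that is, common intervals of both
orders. Once all proper subblocks are matched, the inversions on which the two pairs disagree form a
connected graph if there are any. The non-inversions, agreeing inversions and disagreeing inversions
form a colouring without rainbow triangles, so some colour is disconnected; from this the agreeing
inversions are shown to be disconnected (`OrderPairs.Reduced.not_connectedOn_agreeInv`). A
horizontal reflection of the block interchanges agreeing and disagreeing inversions. After matching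
subblocks again, a surviving disagreement would make the formerly agreeing inversions connected, a
contradiction. The same argument with one order reversed settles the non-inversions. -/

/-! ### Skewness of lines as nonvanishing of a determinant. -/

/-- The determinant of three vectors of `ℝ³`. -/
def vol (u v w : R3) : ℝ :=
  u 0 * (v 1 * w 2 - v 2 * w 1) - u 1 * (v 0 * w 2 - v 2 * w 0) + u 2 * (v 0 * w 1 - v 1 * w 0)

theorem det_of_eq_vol (u v w : R3) : Matrix.det (Matrix.of ![u, v, w]) = vol u v w := by
  simp [Matrix.det_fin_three, vol]; ring

theorem continuous_vol {X : Type*} [TopologicalSpace X] {u v w : X → R3} (hu : Continuous u)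
    (hv : Continuous v) (hw : Continuous w) : Continuous fun t => vol (u t) (v t) (w t) := by
  unfold vol; fun_prop

theorem mem_lineThrough {p d q : R3} : q ∈ lineThrough p d ↔ ∃ c : ℝ, q = p + c • d := by
  rw [lineThrough, AffineSubspace.mem_mk', Submodule.mem_span_singleton]
  refine exists_congr fun c => ?_
  rw [vsub_eq_sub, eq_sub_iff_add_eq, add_comm, eq_comm]

theorem self_mem_lineThrough (p d : R3) : p ∈ lineThrough p d :=
  mem_lineThrough.2 ⟨0, by simp⟩

theorem direction_lineThrough (p d : R3) : (lineThrough p d).direction = Submodule.span ℝ {d} :=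
  AffineSubspace.direction_mk' _ _

theorem lineThrough_add_smul (p d : R3) {l : ℝ} (hl : l ≠ 0) (c : ℝ) :
    lineThrough (p + c • d) (l • d) = lineThrough p d := by
  ext q
  rw [mem_lineThrough, mem_lineThrough]
  constructor
  · rintro ⟨a, rfl⟩
    exact ⟨c + a * l, by module⟩
  · rintro ⟨a, rfl⟩
    refine ⟨(a - c) / l, ?_⟩
    rw [smul_smul, div_mul_cancel₀ _ hl]
    module

theorem exists_of_lineThrough_eq {p d q e : R3} (he : e ≠ 0)
    (h : lineThrough p d = lineThrough q e) : ∃ l c : ℝ, l ≠ 0 ∧ e = l • d ∧ q = p + c • d := by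
  have hq : q ∈ lineThrough p d := h ▸ self_mem_lineThrough q e
  obtain ⟨c, hc⟩ := mem_lineThrough.1 hq
  have h2 : e ∈ Submodule.span ℝ {d} := by
    rw [← direction_lineThrough p d, h, direction_lineThrough]
    exact Submodule.mem_span_singleton_self e
  obtain ⟨l, hl⟩ := Submodule.mem_span_singleton.1 h2
  refine ⟨l, c, ?_, hl.symm, hc⟩
  rintro rfl
  exact he (by rw [← hl, zero_smul])

theorem lineThrough_disjoint_of_vol_ne_zero {p d q e : R3} (h : vol d e (p - q) ≠ 0) :
    Disjoint (lineThrough p d : Set R3) (lineThrough q e : Set R3) := by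
  rw [Set.disjoint_left]
  intro r hr hs
  obtain ⟨a, ha⟩ := mem_lineThrough.1 hr
  obtain ⟨b, hb⟩ := mem_lineThrough.1 hs
  apply h
  have : p - q = b • e - a • d := by
    rw [sub_eq_sub_iff_add_eq_add, ← ha, hb]; abel
  rw [this]; simp [vol]; ring

theorem lineThrough_not_parallel_of_vol_ne_zero {p d q e : R3} (h : vol d e (p - q) ≠ 0) :
    ¬ (lineThrough p d).Parallel (lineThrough q e) := by
  intro hp
  have h2 := hp.direction_eq
  rw [direction_lineThrough, direction_lineThrough] at h2
  have h3 : e ∈ Submodule.span ℝ {d} := h2 ▸ Submodule.mem_span_singleton_self e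
  obtain ⟨l, rfl⟩ := Submodule.mem_span_singleton.1 h3
  apply h
  simp [vol]; ring

theorem lineThrough_parallel {d e : R3} (p q : R3) {l : ℝ} (hl : l ≠ 0) (h : e = l • d) :
    (lineThrough p d).Parallel (lineThrough q e) := by
  refine ⟨q - p, ?_⟩
  subst h
  have h1 : lineThrough q (l • d) = lineThrough q d := by
    simpa using lineThrough_add_smul q d hl 0
  rw [h1, lineThrough, lineThrough, AffineSubspace.map_mk']
  simp

/-- If the determinant vanishes, either the cross product m of the directions is zero and the lines
are parallel, or p - q lies in the plane of the directions and the lines meet. -/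
theorem vol_ne_zero_of_skew {p d q e : R3} (hd : d ≠ 0) (he : e ≠ 0)
    (h1 : Disjoint (lineThrough p d : Set R3) (lineThrough q e : Set R3))
    (h2 : ¬ (lineThrough p d).Parallel (lineThrough q e)) : vol d e (p - q) ≠ 0 := by
  intro h
  set m : R3 := ![d 1 * e 2 - d 2 * e 1, d 2 * e 0 - d 0 * e 2, d 0 * e 1 - d 1 * e 0] with hm
  by_cases hm0 : m = 0
  · have m0 : d 1 * e 2 - d 2 * e 1 = 0 := by simpa [hm] using congrFun hm0 0
    have m1 : d 2 * e 0 - d 0 * e 2 = 0 := by simpa [hm] using congrFun hm0 1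
    have m2 : d 0 * e 1 - d 1 * e 0 = 0 := by simpa [hm] using congrFun hm0 2
    obtain ⟨k, hk⟩ : ∃ k, d k ≠ 0 := by
      by_contra! hc; exact hd (funext hc)
    have hprop : ∀ i, d k * e i = d i * e k := by
      intro i
      fin_cases k <;> fin_cases i <;> simp <;> linarith
    have hek : e = (e k / d k) • d := by
      ext i
      simp only [Pi.smul_apply, smul_eq_mul]
      field_simp
      linarith [hprop i]
    refine h2 (lineThrough_parallel p q (l := e k / d k) ?_ hek)
    intro h0
    rw [h0, zero_smul] at hek
    exact he hek
  · set w := p - q with hw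
    have hn : 0 < m 0 ^ 2 + m 1 ^ 2 + m 2 ^ 2 := by
      by_contra! hc
      apply hm0
      ext i
      have : m i ^ 2 ≤ 0 := by
        fin_cases i <;> simp <;> nlinarith [sq_nonneg (m 0), sq_nonneg (m 1), sq_nonneg (m 2)]
      exact pow_eq_zero_iff two_ne_zero |>.1 (le_antisymm this (sq_nonneg _))
    set N := m 0 ^ 2 + m 1 ^ 2 + m 2 ^ 2 with hN
    -- Cramer's rule in the basis d, e, m, where N is both the squared length of m and the
    -- determinant of d, e, m. The coefficient of m is the determinant of d, e, w, which is zero.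
    have key : N • w = vol w e m • d + vol d w m • e := by
      have hv : vol d e w = 0 := h
      ext i
      fin_cases i <;> simp [hN, hm, vol] at hv ⊢
      · linear_combination (d 1 * e 2 - d 2 * e 1) * hv
      · linear_combination (d 2 * e 0 - d 0 * e 2) * hv
      · linear_combination (d 0 * e 1 - d 1 * e 0) * hv
    have key2 : w = (vol w e m / N) • d + (vol d w m / N) • e := by
      rw [div_eq_inv_mul, div_eq_inv_mul, mul_smul, mul_smul, ← smul_add, ← key, smul_smul,
        inv_mul_cancel₀ hn.ne', one_smul]
    have h3 : p + (-(vol w e m / N)) • d ∈ lineThrough p d := mem_lineThrough.2 ⟨_, rfl⟩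
    refine Set.disjoint_left.1 h1 h3 (mem_lineThrough.2 ⟨vol d w m / N, ?_⟩)
    have h4 : p = q + ((vol w e m / N) • d + (vol d w m / N) • e) := by
      rw [← key2, hw]; abel
    generalize vol w e m / N = a at h4
    generalize vol d w m / N = b at h4 ⊢
    calc p + -a • d = q + (a • d + b • e) + -a • d := congrArg (· + -a • d) h4
      _ = q + b • e := by module

/-- The lines through `p i` with directions `d i` are genuine and pairwise skew. -/
structure IsSkewFrame {n : ℕ} (p d : Fin n → R3) : Prop where
  ne_zero : ∀ i, d i ≠ 0
  vol_ne : ∀ i j, i ≠ j → vol (d i) (d j) (p i - p j) ≠ 0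

namespace IsSkewFrame

variable {n : ℕ} {p d : Fin n → R3}

theorem injective (h : IsSkewFrame p d) : Function.Injective fun i => lineThrough (p i) (d i) := by
  intro i j hij
  by_contra hne
  have h1 : p i ∈ lineThrough (p j) (d j) := by
    have := self_mem_lineThrough (p i) (d i)
    simp only at hij
    rwa [hij] at this
  exact Set.disjoint_left.1 (lineThrough_disjoint_of_vol_ne_zero (h.vol_ne i j hne))
    (self_mem_lineThrough _ _) h1

/-- The configuration formed by the lines of a skew frame. -/
def config (h : IsSkewFrame p d) : SkewConfiguration n where
  lines := Set.range fun i => lineThrough (p i) (d i)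
  card_eq := by
    rw [← Set.image_univ, h.injective.encard_image, Set.encard_univ]
    simp
  isLine := by
    rintro _ ⟨i, rfl⟩
    exact ⟨p i, d i, h.ne_zero i, rfl⟩
  disjoint := by
    rintro _ ⟨i, rfl⟩ _ ⟨j, rfl⟩ hij
    exact lineThrough_disjoint_of_vol_ne_zero (h.vol_ne i j fun e => hij (by rw [e]))
  not_parallel := by
    rintro _ ⟨i, rfl⟩ _ ⟨j, rfl⟩ hij
    exact lineThrough_not_parallel_of_vol_ne_zero (h.vol_ne i j fun e => hij (by rw [e]))

end IsSkewFrame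

theorem SkewConfiguration.isSkewFrame {n : ℕ} (C : SkewConfiguration n) {p d : Fin n → R3}
    (h : C.lines = Set.range fun i => lineThrough (p i) (d i)) : IsSkewFrame p d := by
  have hinj : Function.Injective fun i => lineThrough (p i) (d i) := by
    have h1 := C.card_eq
    rw [h, ← Set.image_univ] at h1
    have h2 : (Set.univ : Set (Fin n)).encard = n := by rw [Set.encard_univ]; simp
    rw [← Set.injOn_univ]
    exact Set.finite_univ.injOn_of_encard_image_eq (h1.trans h2.symm)
  have hmem : ∀ i, lineThrough (p i) (d i) ∈ C.lines := fun i => h ▸ ⟨i, rfl⟩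
  have hd : ∀ i, d i ≠ 0 := by
    intro i h0
    obtain ⟨q, e, he, hq⟩ := C.isLine _ (hmem i)
    have h3 := congrArg AffineSubspace.direction hq
    rw [direction_lineThrough, direction_lineThrough, h0] at h3
    have h4 : e ∈ Submodule.span ℝ {(0 : R3)} := h3 ▸ Submodule.mem_span_singleton_self e
    simp at h4
    exact he h4
  refine ⟨hd, fun i j hij => ?_⟩
  have hne : lineThrough (p i) (d i) ≠ lineThrough (p j) (d j) := fun e => hij (hinj e)
  exact vol_ne_zero_of_skew (hd i) (hd j) (C.disjoint _ (hmem i) _ (hmem j) hne)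
    (C.not_parallel _ (hmem i) _ (hmem j) hne)

theorem SkewConfiguration.exists_frame {n : ℕ} (C : SkewConfiguration n) :
    ∃ p d : Fin n → R3, C.lines = Set.range fun i => lineThrough (p i) (d i) := by
  have hfin : C.lines.Finite := Set.finite_of_encard_eq_coe C.card_eq
  have hc : Nat.card C.lines = n := by
    have h := C.card_eq
    rw [← hfin.cast_ncard_eq, Nat.cast_inj] at h
    rwa [Nat.card_coe_set_eq]
  have := hfin.to_subtype
  let e : Fin n ≃ C.lines := (Finite.equivFinOfCardEq hc).symm
  choose p d hd hL using fun i => C.isLine (e i) (e i).2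
  refine ⟨p, d, ?_⟩
  ext M
  constructor
  · intro hM
    exact ⟨e.symm ⟨M, hM⟩, by simp [← hL]⟩
  · rintro ⟨i, rfl⟩
    simp only [← hL i]
    exact (e i).2

/-- Parametrizations of the same set of skew lines differ by a relabelling, a rescaling of
directions and a shift of base points. The scalars l i are the source of switching. -/
theorem lineThrough_matching {n : ℕ} {p d q e : Fin n → R3} (h : IsSkewFrame p d)
    (h' : IsSkewFrame q e)
    (heq : (Set.range fun i => lineThrough (p i) (d i)) =
      Set.range fun i => lineThrough (q i) (e i)) :
    ∃ (π : Equiv.Perm (Fin n)) (l c : Fin n → ℝ), (∀ i, l i ≠ 0) ∧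
      ∀ i, e (π i) = l i • d i ∧ q (π i) = p i + c i • d i := by
  have h1 : ∀ i, ∃ j, lineThrough (q j) (e j) = lineThrough (p i) (d i) := by
    intro i
    have : lineThrough (p i) (d i) ∈ Set.range fun i => lineThrough (q i) (e i) :=
      heq ▸ ⟨i, rfl⟩
    exact this
  choose f hf using h1
  have hinj : Function.Injective f := by
    intro i j hij
    apply h.injective
    simp only
    rw [← hf i, ← hf j, hij]
  choose l c hl hc using fun i =>
    exists_of_lineThrough_eq (h'.ne_zero (f i)) (hf i).symm
  exact ⟨Equiv.ofBijective f (Finite.injective_iff_bijective.1 hinj), l, c, hl, hc⟩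

/-! ### Isotopy as an equivalence relation, and its linking-sign invariant. -/

open unitInterval in
theorem isotopic_of_path {n : ℕ} {C C' : SkewConfiguration n} (p d : Fin n → I → R3)
    (hp : ∀ i, Continuous (p i)) (hd : ∀ i, Continuous (d i))
    (h : ∀ t, IsSkewFrame (fun i => p i t) fun i => d i t)
    (h0 : C.lines = Set.range fun i => lineThrough (p i 0) (d i 0))
    (h1 : C'.lines = Set.range fun i => lineThrough (p i 1) (d i 1)) : Isotopic C C' :=
  ⟨fun t => (h t).config, ⟨p, d, hp, hd, fun _ => rfl⟩, SkewConfiguration.ext h0.symm,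
    SkewConfiguration.ext h1.symm⟩

theorem Isotopic.refl {n : ℕ} (C : SkewConfiguration n) : Isotopic C C := by
  obtain ⟨p, d, h⟩ := C.exists_frame
  exact ⟨fun _ => C, ⟨fun i _ => p i, fun i _ => d i, fun _ => continuous_const,
    fun _ => continuous_const, fun _ => h⟩, rfl, rfl⟩

theorem Isotopic.symm {n : ℕ} {C C' : SkewConfiguration n} (h : Isotopic C C') :
    Isotopic C' C := by
  obtain ⟨Γ, ⟨p, d, hp, hd, hΓ⟩, h0, h1⟩ := h
  refine ⟨fun t => Γ (unitInterval.symm t), ⟨fun i t => p i (unitInterval.symm t),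
    fun i t => d i (unitInterval.symm t), fun i => ?_, fun i => ?_, fun t => hΓ _⟩, ?_, ?_⟩
  · exact (hp i).comp unitInterval.continuous_symm
  · exact (hd i).comp unitInterval.continuous_symm
  · simpa using h1
  · simpa using h0

/-- The two deformations may parametrize the middle configuration differently, so the second is
reparametrized before the paths are concatenated. -/
theorem Isotopic.trans {n : ℕ} {C₁ C₂ C₃ : SkewConfiguration n} (h : Isotopic C₁ C₂)
    (h' : Isotopic C₂ C₃) : Isotopic C₁ C₃ := by
  obtain ⟨Γ, ⟨p, d, hp, hd, hΓ⟩, h0, h1⟩ := h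
  obtain ⟨Δ, ⟨q, e, hq, he, hΔ⟩, h2, h3⟩ := h'
  have hpd := (Γ 1).isSkewFrame (hΓ 1)
  have hqe := (Δ 0).isSkewFrame (hΔ 0)
  obtain ⟨π, l, c, hl, hm⟩ := lineThrough_matching hpd hqe
    (by rw [← hΓ 1, ← hΔ 0, h1, h2])
  -- Constant coefficients suffice: chosen to match at time 0, they leave the lines unchanged at
  -- every time.
  let q' : Fin n → unitInterval → R3 := fun i t => q (π i) t + (-(c i / l i)) • e (π i) t
  let e' : Fin n → unitInterval → R3 := fun i t => (l i)⁻¹ • e (π i) t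
  have hq' : ∀ i, Continuous (q' i) := by
    intro i
    have h4 := hq (π i)
    have h5 := he (π i)
    fun_prop
  have he' : ∀ i, Continuous (e' i) := by
    intro i
    have h5 := he (π i)
    fun_prop
  have hq0 : ∀ i, q' i 0 = p i 1 := by
    intro i
    simp only [q', (hm i).1, (hm i).2, smul_smul]
    rw [neg_mul, div_mul_cancel₀ _ (hl i)]
    module
  have he0 : ∀ i, e' i 0 = d i 1 := by
    intro i
    simp only [e', (hm i).1, smul_smul]
    rw [inv_mul_cancel₀ (hl i), one_smul]
  have hΔ' : ∀ t, (Δ t).lines = Set.range fun i => lineThrough (q' i t) (e' i t) := by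
    intro t
    rw [hΔ t, ← π.surjective.range_comp]
    congr 1
    ext1 i
    simp only [q', e', Function.comp]
    rw [lineThrough_add_smul _ _ (inv_ne_zero (hl i))]
  let P : ∀ i, Path (p i 0) (p i 1) := fun i => ⟨⟨p i, hp i⟩, rfl, rfl⟩
  let Q : ∀ i, Path (p i 1) (q' i 1) := fun i => ⟨⟨q' i, hq' i⟩, hq0 i, rfl⟩
  let D : ∀ i, Path (d i 0) (d i 1) := fun i => ⟨⟨d i, hd i⟩, rfl, rfl⟩
  let E : ∀ i, Path (d i 1) (e' i 1) := fun i => ⟨⟨e' i, he' i⟩, he0 i, rfl⟩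
  have hline : ∀ t, ∃ S : SkewConfiguration n, S.lines = Set.range fun i =>
      lineThrough ((P i).trans (Q i) t) ((D i).trans (E i) t) := by
    intro t
    by_cases ht : (t : ℝ) ≤ 1 / 2
    · refine ⟨Γ ⟨2 * t, (unitInterval.mul_pos_mem_iff zero_lt_two).2 ⟨t.2.1, ht⟩⟩, ?_⟩
      simp only [Path.trans_apply, ht, dif_pos]
      exact hΓ _
    · refine ⟨Δ ⟨2 * t - 1, unitInterval.two_mul_sub_one_mem_iff.2
        ⟨(not_le.1 ht).le, t.2.2⟩⟩, ?_⟩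
      simp only [Path.trans_apply, ht, dif_neg, not_false_iff]
      exact hΔ' _
  choose S hS using hline
  refine ⟨S, ⟨fun i => (P i).trans (Q i), fun i => (D i).trans (E i),
    fun i => ((P i).trans (Q i)).continuous, fun i => ((D i).trans (E i)).continuous, hS⟩, ?_, ?_⟩
  · ext1
    rw [hS, ← h0, hΓ]
    simp
  · ext1
    rw [hS, ← h3, hΔ']
    simp

theorem mul_pos_of_path {f : unitInterval → ℝ} (hf : Continuous f) (h : ∀ t, f t ≠ 0) :
    0 < f 0 * f 1 := by
  by_contra! hc
  have h0 : (0 : ℝ) ∈ Set.uIcc (f 0) (f 1) := by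
    rw [Set.mem_uIcc]
    rcases mul_nonpos_iff.1 hc with h | h
    · right; exact ⟨h.2, h.1⟩
    · left; exact ⟨h.1, h.2⟩
  obtain ⟨t, -, ht⟩ := intermediate_value_uIcc (a := (0 : unitInterval)) (b := 1)
    hf.continuousOn h0
  exact h t ht

/-- The linking signs of the lines of isotopic configurations agree up to relabelling and
switching (reversing the orientations of some lines). -/
theorem Isotopic.exists_switching {n : ℕ} {p d q e : Fin n → R3} (h : IsSkewFrame p d)
    (h' : IsSkewFrame q e) (hiso : Isotopic h.config h'.config) :
    ∃ (π : Equiv.Perm (Fin n)) (l : Fin n → ℝ), (∀ i, l i ≠ 0) ∧ ∀ i j, i ≠ j →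
      0 < l i * l j * vol (d i) (d j) (p i - p j) *
        vol (e (π i)) (e (π j)) (q (π i) - q (π j)) := by
  obtain ⟨Γ, ⟨P, D, hP, hD, hΓ⟩, h0, h1⟩ := hiso
  have hF := fun t => (Γ t).isSkewFrame (hΓ t)
  obtain ⟨π₀, l₀, c₀, hl₀, hm₀⟩ := lineThrough_matching h (hF 0) (by rw [← hΓ 0, h0]; rfl)
  obtain ⟨π₁, l₁, c₁, hl₁, hm₁⟩ := lineThrough_matching (hF 1) h' (by rw [← hΓ 1, h1]; rfl)
  refine ⟨π₀.trans π₁, fun i => l₀ i * l₁ (π₀ i), fun i => mul_ne_zero (hl₀ i) (hl₁ _), ?_⟩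
  intro i j hij
  have hij' : π₀ i ≠ π₀ j := fun e => hij (π₀.injective e)
  have key := mul_pos_of_path (f := fun t => vol (D (π₀ i) t) (D (π₀ j) t)
    (P (π₀ i) t - P (π₀ j) t)) (continuous_vol (hD _) (hD _) ((hP _).sub (hP _)))
    (fun t => (hF t).vol_ne _ _ hij')
  simp only [(hm₀ _).1, (hm₀ _).2] at key
  simp only [Equiv.trans_apply, (hm₁ _).1, (hm₁ _).2]
  have e1 : vol (l₀ i • d i) (l₀ j • d j) (p i + c₀ i • d i - (p j + c₀ j • d j)) =
      l₀ i * l₀ j * vol (d i) (d j) (p i - p j) := by simp [vol]; ring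
  have e2 : vol (l₁ (π₀ i) • D (π₀ i) 1) (l₁ (π₀ j) • D (π₀ j) 1)
      (P (π₀ i) 1 + c₁ (π₀ i) • D (π₀ i) 1 - (P (π₀ j) 1 + c₁ (π₀ j) • D (π₀ j) 1)) =
      l₁ (π₀ i) * l₁ (π₀ j) * vol (D (π₀ i) 1) (D (π₀ j) 1) (P (π₀ i) 1 - P (π₀ j) 1) := by
    simp [vol]; ring
  rw [e1] at key
  rw [e2]
  have h5 : 0 < (l₁ (π₀ i) * l₁ (π₀ j)) ^ 2 :=
    sq_pos_of_ne_zero (mul_ne_zero (hl₁ _) (hl₁ _))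
  have h6 := mul_pos h5 key
  exact lt_of_lt_of_eq h6 (by ring)

/-! ### Connectivity of the group of invertible matrices. -/

theorem JoinedIn.of_continuous {E : Type*} [TopologicalSpace E] {S : Set E} {f : ℝ → E}
    (hf : Continuous f) (h : ∀ t ∈ Set.Icc (0 : ℝ) 1, f t ∈ S) : JoinedIn S (f 0) (f 1) :=
  ⟨⟨⟨fun t => f t, by fun_prop⟩, by simp, by simp⟩, fun t => h t t.2⟩

theorem JoinedIn.mul_of_mul_mem {E : Type*} [TopologicalSpace E] [Mul E] [ContinuousMul E]
    {S : Set E} (hS : ∀ a ∈ S, ∀ b ∈ S, a * b ∈ S) {a b c d : E} (h : JoinedIn S a b)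
    (h' : JoinedIn S c d) : JoinedIn S (a * c) (b * d) := by
  obtain ⟨γ, hγ⟩ := h
  obtain ⟨δ, hδ⟩ := h'
  exact ⟨⟨⟨fun t => γ t * δ t, by fun_prop⟩, by simp, by simp⟩, fun t => hS _ (hγ t) _ (hδ t)⟩

/-- Real `3 × 3` matrices of nonzero determinant. -/
def invertibleMatrices : Set (Matrix (Fin 3) (Fin 3) ℝ) := {M | M.det ≠ 0}

theorem invertibleMatrices_mul :
    ∀ A ∈ invertibleMatrices, ∀ B ∈ invertibleMatrices, A * B ∈ invertibleMatrices := by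
  intro A hA B hB
  simpa [invertibleMatrices] using ⟨hA, hB⟩

/-- `M` can be connected to `diag(±1, 1, 1)` through invertible matrices. -/
def JoinedToSign (M : Matrix (Fin 3) (Fin 3) ℝ) : Prop :=
  ∃ ε : ℝ, (ε = 1 ∨ ε = -1) ∧
    JoinedIn invertibleMatrices M (Matrix.diagonal ![ε, 1, 1])

theorem JoinedToSign.mul {A B : Matrix (Fin 3) (Fin 3) ℝ} (hA : JoinedToSign A)
    (hB : JoinedToSign B) : JoinedToSign (A * B) := by
  obtain ⟨ε, hε, h⟩ := hA
  obtain ⟨δ, hδ, h'⟩ := hB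
  refine ⟨ε * δ, by rcases hε with rfl | rfl <;> rcases hδ with rfl | rfl <;> simp, ?_⟩
  have := h.mul_of_mul_mem invertibleMatrices_mul h'
  have e : (fun i => (![ε, 1, 1] : Fin 3 → ℝ) i * (![δ, 1, 1] : Fin 3 → ℝ) i) =
      ![ε * δ, 1, 1] := by
    ext i
    fin_cases i <;> simp
  rwa [Matrix.diagonal_mul_diagonal, e] at this

theorem exists_sign_between {a : ℝ} (ha : a ≠ 0) : ∃ ε : ℝ, (ε = 1 ∨ ε = -1) ∧
    ∀ t ∈ Set.Icc (0 : ℝ) 1, (1 - t) * a + t * ε ≠ 0 := by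
  rcases ha.lt_or_gt with h | h
  · refine ⟨-1, Or.inr rfl, fun t ht => ne_of_lt ?_⟩
    rcases ht.1.eq_or_lt with h0 | h0
    · simpa [← h0]
    · nlinarith [mul_nonneg (sub_nonneg.2 ht.2) (neg_nonneg.2 h.le)]
  · refine ⟨1, Or.inl rfl, fun t ht => ne_of_gt ?_⟩
    rcases ht.1.eq_or_lt with h0 | h0
    · simpa [← h0]
    · nlinarith [mul_nonneg (sub_nonneg.2 ht.2) h.le]

theorem joinedToSign_diagonal_fst {a : ℝ} (ha : a ≠ 0) :
    JoinedToSign (Matrix.diagonal ![a, 1, 1]) := by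
  obtain ⟨ε, hε, h⟩ := exists_sign_between ha
  refine ⟨ε, hε, ?_⟩
  have := JoinedIn.of_continuous (S := invertibleMatrices)
    (f := fun t : ℝ => Matrix.diagonal ![(1 - t) * a + t * ε, 1, 1])
    (Continuous.matrix_diagonal (continuous_pi fun i => by fin_cases i <;> simp <;> fun_prop))
    (fun t ht => by simpa [invertibleMatrices, Fin.prod_univ_three] using h t ht)
  simpa using this

theorem joinedToSign_diagonal_snd {a : ℝ} (ha : a ≠ 0) :
    JoinedToSign (Matrix.diagonal ![1, a, 1]) := by
  obtain ⟨ε, hε, h⟩ := exists_sign_between ha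
  refine ⟨ε, hε, ?_⟩
  have h1 := JoinedIn.of_continuous (S := invertibleMatrices)
    (f := fun t : ℝ => Matrix.diagonal ![1, (1 - t) * a + t * ε, 1])
    (Continuous.matrix_diagonal (continuous_pi fun i => by fin_cases i <;> simp <;> fun_prop))
    (fun t ht => by simpa [invertibleMatrices, Fin.prod_univ_three] using h t ht)
  have h1' : JoinedIn invertibleMatrices (Matrix.diagonal ![1, a, 1])
    (Matrix.diagonal ![1, ε, 1]) := by simpa using h1
  refine h1'.trans ?_
  rcases hε with rfl | rfl
  · exact JoinedIn.refl (by simp [invertibleMatrices, Fin.prod_univ_three])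
  -- A path of plane reflections, all of determinant -1, moves the sign from the second diagonal
  -- entry to the first.
  · have h2 := JoinedIn.of_continuous (S := invertibleMatrices)
      (f := fun t : ℝ => Matrix.of ![![Real.cos (t * Real.pi), Real.sin (t * Real.pi), 0],
        ![Real.sin (t * Real.pi), -Real.cos (t * Real.pi), 0], ![0, 0, 1]])
      (continuous_matrix fun i j => by fin_cases i <;> fin_cases j <;> simp <;> fun_prop)
      (fun t _ => by
        have := Real.sin_sq_add_cos_sq (t * Real.pi)
        have h3 : -(Real.cos (t * Real.pi) * Real.cos (t * Real.pi)) -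
          Real.sin (t * Real.pi) * Real.sin (t * Real.pi) = -1 := by linarith
        simp [invertibleMatrices, Matrix.det_fin_three, h3])
    convert h2 using 1 <;> ext i j <;> fin_cases i <;> fin_cases j <;> simp

theorem joinedToSign_diagonal_trd {a : ℝ} (ha : a ≠ 0) :
    JoinedToSign (Matrix.diagonal ![1, 1, a]) := by
  obtain ⟨ε, hε, h⟩ := exists_sign_between ha
  refine ⟨ε, hε, ?_⟩
  have h1 := JoinedIn.of_continuous (S := invertibleMatrices)
    (f := fun t : ℝ => Matrix.diagonal ![1, 1, (1 - t) * a + t * ε])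
    (Continuous.matrix_diagonal (continuous_pi fun i => by fin_cases i <;> simp <;> fun_prop))
    (fun t ht => by simpa [invertibleMatrices, Fin.prod_univ_three] using h t ht)
  have h1' : JoinedIn invertibleMatrices (Matrix.diagonal ![1, 1, a])
    (Matrix.diagonal ![1, 1, ε]) := by simpa using h1
  refine h1'.trans ?_
  rcases hε with rfl | rfl
  · exact JoinedIn.refl (by simp [invertibleMatrices, Fin.prod_univ_three])
  · have h2 := JoinedIn.of_continuous (S := invertibleMatrices)
      (f := fun t : ℝ => Matrix.of ![![Real.cos (t * Real.pi), 0, Real.sin (t * Real.pi)],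
        ![0, 1, 0], ![Real.sin (t * Real.pi), 0, -Real.cos (t * Real.pi)]])
      (continuous_matrix fun i j => by fin_cases i <;> fin_cases j <;> simp <;> fun_prop)
      (fun t _ => by
        have := Real.sin_sq_add_cos_sq (t * Real.pi)
        have h3 : -(Real.cos (t * Real.pi) * Real.cos (t * Real.pi)) -
          Real.sin (t * Real.pi) * Real.sin (t * Real.pi) = -1 := by linarith
        simp [invertibleMatrices, Matrix.det_fin_three, h3])
    convert h2 using 1 <;> ext i j <;> fin_cases i <;> fin_cases j <;> simp

/-- Gaussian elimination writes the matrix as a product of transvections and a diagonal matrix.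
Transvections contract to the identity, and paths can be multiplied. -/
theorem joinedToSign_of_det_ne_zero {M : Matrix (Fin 3) (Fin 3) ℝ} (hM : M.det ≠ 0) :
    JoinedToSign M := by
  refine Matrix.diagonal_transvection_induction_of_det_ne_zero JoinedToSign M hM ?_ ?_ ?_
  · intro D hD
    have hD' : ∀ i, D i ≠ 0 := by
      rw [Matrix.det_diagonal] at hD
      exact fun i => Finset.prod_ne_zero_iff.1 hD i (Finset.mem_univ i)
    have := ((joinedToSign_diagonal_fst (hD' 0)).mul (joinedToSign_diagonal_snd (hD' 1))).mul
      (joinedToSign_diagonal_trd (hD' 2))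
    rw [Matrix.diagonal_mul_diagonal, Matrix.diagonal_mul_diagonal] at this
    convert this using 2
    ext i
    fin_cases i <;> simp
  · intro t
    refine ⟨1, Or.inl rfl, ?_⟩
    have h1 := JoinedIn.of_continuous (S := invertibleMatrices)
      (f := fun s : ℝ => Matrix.transvection t.i t.j ((1 - s) * t.c))
      (by
        unfold Matrix.transvection
        refine continuous_const.add (continuous_matrix fun i j => ?_)
        simp only [Matrix.single_apply]
        split_ifs <;> fun_prop)
      (fun s _ => by simp [invertibleMatrices, t.hij])
    have h3 : (Matrix.diagonal ![1, 1, 1] : Matrix (Fin 3) (Fin 3) ℝ) = 1 := by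
      ext i j; fin_cases i <;> fin_cases j <;> simp
    rw [h3]
    simpa [Matrix.TransvectionStruct.toMatrix] using h1
  · intro A B _ _ hA hB
    exact hA.mul hB

/-- Positively oriented bases of `ℝ³` can be deformed into the standard basis. -/
theorem exists_path_of_vol_pos {u w m : R3} (h : 0 < vol u w m) :
    ∃ U W M : unitInterval → R3, Continuous U ∧ Continuous W ∧ Continuous M ∧
      (∀ t, vol (U t) (W t) (M t) ≠ 0) ∧ U 0 = u ∧ W 0 = w ∧ M 0 = m ∧
      U 1 = ![1, 0, 0] ∧ W 1 = ![0, 1, 0] ∧ M 1 = ![0, 0, 1] := by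
  obtain ⟨ε, hε, γ, hγ⟩ := joinedToSign_of_det_ne_zero (M := Matrix.of ![u, w, m])
    (by rw [det_of_eq_vol]; exact h.ne')
  have hpos := mul_pos_of_path (f := fun t => (γ t).det)
    (Continuous.matrix_det γ.continuous) hγ
  -- The determinant keeps its sign along the path, so a positive start excludes ε = -1.
  have h1 : ε = 1 := by
    rcases hε with h1 | rfl
    · exact h1
    · simp only [γ.source, γ.target, det_of_eq_vol, Matrix.det_diagonal, Fin.prod_univ_three] at hpos
      simp at hpos
      linarith
  subst h1
  have hv : ∀ t, vol (γ t 0) (γ t 1) (γ t 2) ≠ 0 := by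
    intro t
    have := hγ t
    have h2 : γ t = Matrix.of ![γ t 0, γ t 1, γ t 2] := by
      ext i j; fin_cases i <;> rfl
    change (γ t).det ≠ 0 at this
    rwa [h2, det_of_eq_vol] at this
  have hc : ∀ i, Continuous fun t => γ t i := fun i => (continuous_apply i).comp γ.continuous
  refine ⟨fun t => γ t 0, fun t => γ t 1, fun t => γ t 2, hc 0, hc 1, hc 2, hv, ?_⟩
  simp only [γ.source, γ.target]
  refine ⟨rfl, rfl, rfl, ?_, ?_, ?_⟩ <;> ext i <;> fin_cases i <;> simp

/-! ### Normal forms of spindles and their motions. -/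

theorem isSkewFrame_std {n : ℕ} {x y : Fin n → ℝ} (hx : Function.Injective x)
    (hy : Function.Injective y) :
    IsSkewFrame (fun i => (![x i, 0, 0] : R3)) (fun i => (![0, y i, 1] : R3)) := by
  refine ⟨fun i h => by simpa using congrFun h 2, fun i j hij => ?_⟩
  have h1 : x i - x j ≠ 0 := sub_ne_zero.2 (hx.ne hij)
  have h2 : y i - y j ≠ 0 := sub_ne_zero.2 (hy.ne hij)
  have h3 : vol ![0, y i, 1] ![0, y j, 1] (![x i, 0, 0] - ![x j, 0, 0]) =
      (x i - x j) * (y i - y j) := by simp [vol]; ring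
  rw [h3]
  exact mul_ne_zero h1 h2

/-- The spindle with lines through `(x i, 0, 0)` in direction `(0, y i, 1)`. -/
def stdConfig {n : ℕ} {x y : Fin n → ℝ} (hx : Function.Injective x)
    (hy : Function.Injective y) : SkewConfiguration n :=
  (isSkewFrame_std hx hy).config

section

variable {n : ℕ} {x y x' y' : Fin n → ℝ}

theorem injective_interpolation (hx : Function.Injective x)
    (h : ∀ i j, x i < x j → x' i < x' j) {t : ℝ} (ht : t ∈ Set.Icc (0 : ℝ) 1) :
    Function.Injective fun i => (1 - t) * x i + t * x' i := by
  have key : ∀ i j, x i < x j → (1 - t) * x i + t * x' i < (1 - t) * x j + t * x' j := by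
    intro i j hij
    rcases ht.2.eq_or_lt with h1 | h1
    · simpa [h1] using h i j hij
    · have h2 := mul_lt_mul_of_pos_left hij (sub_pos.2 h1)
      have h3 := mul_le_mul_of_nonneg_left (h i j hij).le ht.1
      linarith
  intro i j hij
  by_contra hne
  rcases (hx.ne hne).lt_or_gt with h1 | h1
  · exact (key i j h1).ne hij
  · exact (key j i h1).ne hij.symm

theorem stdConfig_isotopic_of_order (hx : Function.Injective x) (hy : Function.Injective y)
    (hx' : Function.Injective x') (hy' : Function.Injective y')
    (h : ∀ i j, x i < x j → x' i < x' j) (h' : ∀ i j, y i < y j → y' i < y' j) :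
    Isotopic (stdConfig hx hy) (stdConfig hx' hy') := by
  refine isotopic_of_path (fun i t => ![(1 - t) * x i + t * x' i, 0, 0])
    (fun i t => ![0, (1 - t) * y i + t * y' i, 1]) (fun i => ?_) (fun i => ?_)
    (fun t => isSkewFrame_std (injective_interpolation hx h t.2)
      (injective_interpolation hy h' t.2)) ?_ ?_
  · exact continuous_pi fun k => by fin_cases k <;> simp <;> fun_prop
  · exact continuous_pi fun k => by fin_cases k <;> simp <;> fun_prop
  · simp [stdConfig, IsSkewFrame.config]
  · simp [stdConfig, IsSkewFrame.config]

/-- Rotating the points `y i = tan (φ i)` of a projective line. -/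
theorem stdConfig_isotopic_of_rotation (hx : Function.Injective x) (hy : Function.Injective y)
    (hy' : Function.Injective y') (φ : Fin n → ℝ) (τ : ℝ)
    (hφ : ∀ i j, i ≠ j → Real.sin (φ i - φ j) ≠ 0) (hc : ∀ i, Real.cos (φ i) ≠ 0)
    (hc' : ∀ i, Real.cos (φ i + τ) ≠ 0) (h : ∀ i, y i = Real.tan (φ i))
    (h' : ∀ i, y' i = Real.tan (φ i + τ)) :
    Isotopic (stdConfig hx hy) (stdConfig hx hy') := by
  have hline : ∀ (p : R3) (θ : ℝ), Real.cos θ ≠ 0 →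
      lineThrough p ![0, Real.sin θ, Real.cos θ] = lineThrough p ![0, Real.tan θ, 1] := by
    intro p θ hθ
    have e : (![0, Real.sin θ, Real.cos θ] : R3) = Real.cos θ • ![0, Real.tan θ, 1] := by
      ext k
      fin_cases k <;> simp [Real.tan_eq_sin_div_cos]
      field_simp
    rw [e]
    simpa using lineThrough_add_smul p ![0, Real.tan θ, 1] hθ 0
  refine isotopic_of_path (fun i _ => ![x i, 0, 0])
    (fun i t => ![0, Real.sin (φ i + t * τ), Real.cos (φ i + t * τ)])
    (fun i => continuous_const) (fun i => ?_) (fun t => ⟨fun i h0 => ?_, fun i j hij => ?_⟩) ?_ ?_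
  · exact continuous_pi fun k => by fin_cases k <;> simp <;> fun_prop
  · have h1 : Real.sin (φ i + t * τ) = 0 := by simpa using congrFun h0 1
    have h2 : Real.cos (φ i + t * τ) = 0 := by simpa using congrFun h0 2
    have := Real.sin_sq_add_cos_sq (φ i + t * τ)
    rw [h1, h2] at this
    norm_num at this
  -- The determinant depends only on differences of angles, which a common rotation preserves.
  · have h3 : vol ![0, Real.sin (φ i + t * τ), Real.cos (φ i + t * τ)]
        ![0, Real.sin (φ j + t * τ), Real.cos (φ j + t * τ)] (![x i, 0, 0] - ![x j, 0, 0]) =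
        (x i - x j) * Real.sin (φ i - φ j) := by
      have : φ i - φ j = (φ i + t * τ) - (φ j + t * τ) := by ring
      rw [this, Real.sin_sub]
      simp [vol]; ring
    rw [h3]
    exact mul_ne_zero (sub_ne_zero.2 (hx.ne hij)) (hφ i j hij)
  · simp [stdConfig, IsSkewFrame.config, h, hline _ _ (hc _)]
  · simp [stdConfig, IsSkewFrame.config, h', hline _ _ (hc' _)]

/-- Moving the lines of a block that stays close to the `z`-axis direction, keeping the other
lines fixed. -/
theorem stdConfig_isotopic_of_block_motion (hx : Function.Injective x)
    (hy : Function.Injective y) (hx' : Function.Injective x') (hy' : Function.Injective y')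
    (S : Set (Fin n)) (q₁ q₂ δ₁ δ₂ : Fin n → ℝ → ℝ)
    (c₁ : ∀ i, Continuous (q₁ i)) (c₂ : ∀ i, Continuous (q₂ i)) (c₃ : ∀ i, Continuous (δ₁ i))
    (c₄ : ∀ i, Continuous (δ₂ i))
    (hb : ∀ i ∈ S, ∀ t ∈ Set.Icc (0 : ℝ) 1,
      |q₁ i t| ≤ 1 / 4 ∧ |q₂ i t| ≤ 1 / 4 ∧ |δ₁ i t| ≤ 1 / 4 ∧ |δ₂ i t| ≤ 1 / 4)
    (hn : ∀ i ∈ S, ∀ j ∈ S, i ≠ j → ∀ t,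
      (δ₂ i t - δ₂ j t) * (q₁ i t - q₁ j t) - (δ₁ i t - δ₁ j t) * (q₂ i t - q₂ j t) ≠ 0)
    (h0 : ∀ i ∈ S, q₁ i 0 = x i ∧ q₂ i 0 = 0 ∧ δ₁ i 0 = 0 ∧ δ₂ i 0 = y i)
    (h1 : ∀ i ∈ S, q₁ i 1 = x' i ∧ q₂ i 1 = 0 ∧ δ₁ i 1 = 0 ∧ δ₂ i 1 = y' i)
    (hout : ∀ i ∉ S, 1 ≤ x i ∧ 1 ≤ y i ∧ x' i = x i ∧ y' i = y i) :
    Isotopic (stdConfig hx hy) (stdConfig hx' hy') := by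
  classical
  -- Block lines stay within 1/4 of the z-axis data while outer lines have position and slope at
  -- least 1. The main product is thus at least 9/16 and the correction at most 1/16.
  have hcross : ∀ i ∈ S, ∀ j ∉ S, ∀ t ∈ Set.Icc (0 : ℝ) 1,
      0 < (δ₂ i t - y j) * (q₁ i t - x j) - δ₁ i t * q₂ i t := by
    intro i hi j hj t ht
    obtain ⟨b1, b2, b3, b4⟩ := hb i hi t ht
    obtain ⟨e1, e2, -, -⟩ := hout j hj
    have f1 : 3 / 4 ≤ x j - q₁ i t := by linarith [(abs_le.1 b1).2]
    have f2 : 3 / 4 ≤ y j - δ₂ i t := by linarith [(abs_le.1 b4).2]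
    have f3 : 3 / 4 * (3 / 4) ≤ (y j - δ₂ i t) * (x j - q₁ i t) :=
      mul_le_mul f2 f1 (by norm_num) (by linarith)
    have f4 : |δ₁ i t * q₂ i t| ≤ 1 / 4 * (1 / 4) := by
      rw [abs_mul]; exact mul_le_mul b3 b2 (abs_nonneg _) (by norm_num)
    have f5 := (abs_le.1 f4).2
    nlinarith
  refine isotopic_of_path (fun i t => if i ∈ S then ![q₁ i t, q₂ i t, 0] else ![x i, 0, 0])
    (fun i t => if i ∈ S then ![δ₁ i t, δ₂ i t, 1] else ![0, y i, 1])
    (fun i => ?_) (fun i => ?_) (fun t => ⟨fun i h0 => ?_, fun i j hij => ?_⟩) ?_ ?_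
  · have := c₁ i
    have := c₂ i
    split_ifs
    · exact continuous_pi fun k => by fin_cases k <;> simp <;> fun_prop
    · exact continuous_const
  · have := c₃ i
    have := c₄ i
    split_ifs
    · exact continuous_pi fun k => by fin_cases k <;> simp <;> fun_prop
    · exact continuous_const
  · have := congrFun h0 2
    split_ifs at this <;> simp at this
  · by_cases hi : i ∈ S <;> by_cases hj : j ∈ S <;> simp only [hi, hj, if_true, if_false]
    · convert hn i hi j hj hij t using 1
      simp [vol]; ring
    · convert (hcross i hi j hj t t.2).ne' using 1
      simp [vol]; ring
    · convert (hcross j hj i hi t t.2).ne' using 1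
      simp [vol]; ring
    · exact (isSkewFrame_std hx hy).vol_ne i j hij
  · simp only [stdConfig, IsSkewFrame.config]
    congr 1
    ext1 i
    by_cases hi : i ∈ S
    · simp [hi, h0 i hi]
    · simp [hi]
  · simp only [stdConfig, IsSkewFrame.config]
    congr 1
    ext1 i
    by_cases hi : i ∈ S
    · simp [hi, h1 i hi]
    · simp [hi, hout i hi]

theorem abs_convex_comb_le {a b c r : ℝ} (ha : |a| ≤ r) (hb : |b| ≤ r) (hc : |c| ≤ 1) :
    |(a + b) / 2 + (a - b) / 2 * c| ≤ r := by
  rw [abs_le] at *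
  constructor <;> nlinarith [mul_nonneg (sub_nonneg.2 ha.1) (sub_nonneg.2 hc.1),
    mul_nonneg (sub_nonneg.2 ha.2) (sub_nonneg.2 hc.1),
    mul_nonneg (sub_nonneg.2 hb.1) (sub_nonneg.2 hc.2),
    mul_nonneg (sub_nonneg.2 hb.2) (sub_nonneg.2 hc.2)]

theorem abs_mul_le_of_abs_le_one {a c r : ℝ} (ha : |a| ≤ r) (hc : |c| ≤ 1) : |a * c| ≤ r := by
  rw [abs_mul]
  exact (mul_le_of_le_one_right (abs_nonneg _) hc).trans ha

/-- The matrix with rows (q₁, q₂) and (δ₁, δ₂) is the conjugate of diag(x i, y i) by a rotation of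
angle tπ/2. The determinant of the difference of two such matrices is therefore constant in t, and
at t = 1 the diagonal entries have changed places. -/
theorem stdConfig_isotopic_of_block_swap (hx : Function.Injective x)
    (hy : Function.Injective y) (hx' : Function.Injective x') (hy' : Function.Injective y')
    (S : Set (Fin n)) (hS : ∀ i ∈ S, |x i| ≤ 1 / 4 ∧ |y i| ≤ 1 / 4 ∧ x' i = y i ∧ y' i = x i)
    (hout : ∀ i ∉ S, 1 ≤ x i ∧ 1 ≤ y i ∧ x' i = x i ∧ y' i = y i) :
    Isotopic (stdConfig hx hy) (stdConfig hx' hy') := by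
  refine stdConfig_isotopic_of_block_motion hx hy hx' hy' S
    (fun i t => (x i + y i) / 2 + (x i - y i) / 2 * Real.cos (t * Real.pi))
    (fun i t => (x i - y i) / 2 * Real.sin (t * Real.pi))
    (fun i t => (x i - y i) / 2 * Real.sin (t * Real.pi))
    (fun i t => (x i + y i) / 2 - (x i - y i) / 2 * Real.cos (t * Real.pi))
    (fun i => by fun_prop) (fun i => by fun_prop) (fun i => by fun_prop) (fun i => by fun_prop)
    ?_ ?_ ?_ ?_ hout
  · intro i hi t _
    obtain ⟨h1, h2, -, -⟩ := hS i hi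
    have h3 : |(x i - y i) / 2| ≤ 1 / 4 := by
      rw [abs_le] at *
      constructor <;> linarith
    have h4 := Real.abs_cos_le_one (t * Real.pi)
    have h5 := Real.abs_sin_le_one (t * Real.pi)
    refine ⟨abs_convex_comb_le h1 h2 h4, abs_mul_le_of_abs_le_one h3 h5,
      abs_mul_le_of_abs_le_one h3 h5, ?_⟩
    have := abs_convex_comb_le h2 h1 h4
    convert this using 2
    ring
  · intro i _ j _ hij t
    have h3 : (x i - x j) * (y i - y j) ≠ 0 :=
      mul_ne_zero (sub_ne_zero.2 (hx.ne hij)) (sub_ne_zero.2 (hy.ne hij))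
    convert h3 using 1
    have := Real.sin_sq_add_cos_sq (t * Real.pi)
    linear_combination (-((x i - y i) / 2 - (x j - y j) / 2) ^ 2) * this
  · intro i _
    simp; constructor <;> ring
  · intro i hi
    obtain ⟨-, -, h1, h2⟩ := hS i hi
    simp [h1, h2]; constructor <;> ring

/-- The block is turned rigidly about the z-axis by the angle tπ, so determinants within the block
are constant. -/
theorem stdConfig_isotopic_of_block_rotation (hx : Function.Injective x)
    (hy : Function.Injective y) (hx' : Function.Injective x') (hy' : Function.Injective y')
    (S : Set (Fin n)) (hS : ∀ i ∈ S, |x i| ≤ 1 / 4 ∧ |y i| ≤ 1 / 4 ∧ x' i = -x i ∧ y' i = -y i)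
    (hout : ∀ i ∉ S, 1 ≤ x i ∧ 1 ≤ y i ∧ x' i = x i ∧ y' i = y i) :
    Isotopic (stdConfig hx hy) (stdConfig hx' hy') := by
  refine stdConfig_isotopic_of_block_motion hx hy hx' hy' S
    (fun i t => x i * Real.cos (t * Real.pi)) (fun i t => x i * Real.sin (t * Real.pi))
    (fun i t => y i * (-Real.sin (t * Real.pi))) (fun i t => y i * Real.cos (t * Real.pi))
    (fun i => by fun_prop) (fun i => by fun_prop) (fun i => by fun_prop) (fun i => by fun_prop)
    ?_ ?_ ?_ ?_ hout
  · intro i hi t _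
    obtain ⟨h1, h2, -, -⟩ := hS i hi
    have h4 := Real.abs_cos_le_one (t * Real.pi)
    have h5 := Real.abs_sin_le_one (t * Real.pi)
    exact ⟨abs_mul_le_of_abs_le_one h1 h4, abs_mul_le_of_abs_le_one h1 h5,
      abs_mul_le_of_abs_le_one h2 (by rwa [abs_neg]), abs_mul_le_of_abs_le_one h2 h4⟩
  · intro i _ j _ hij t
    have h3 : (x i - x j) * (y i - y j) ≠ 0 :=
      mul_ne_zero (sub_ne_zero.2 (hx.ne hij)) (sub_ne_zero.2 (hy.ne hij))
    convert h3 using 1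
    have := Real.sin_sq_add_cos_sq (t * Real.pi)
    linear_combination ((x i - x j) * (y i - y j)) * this
  · intro i _
    simp
  · intro i hi
    obtain ⟨-, -, h1, h2⟩ := hS i hi
    simp [h1, h2]

end

/-! ### Normal forms given by two permutations. -/

section

variable {n : ℕ}

theorem injective_comp_perm {X : ℕ → ℝ} (hX : StrictMono X) (a : Equiv.Perm (Fin n)) :
    Function.Injective fun i => X (a i) :=
  hX.injective.comp (Fin.val_injective.comp a.injective)

/-- The standard spindle whose `i`-th line meets the axis at abscissa `a i` and has slope
`b i`. -/
def permConfig (a b : Equiv.Perm (Fin n)) : SkewConfiguration n :=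
  stdConfig (injective_comp_perm Nat.strictMono_cast a) (injective_comp_perm Nat.strictMono_cast b)

theorem permConfig_isotopic_stdConfig (a b : Equiv.Perm (Fin n)) {x y : Fin n → ℝ}
    (hx : Function.Injective x) (hy : Function.Injective y)
    (h : ∀ i j, a i < a j → x i < x j) (h' : ∀ i j, b i < b j → y i < y j) :
    Isotopic (permConfig a b) (stdConfig hx hy) :=
  stdConfig_isotopic_of_order _ _ _ _ (fun i j hij => h i j (by simpa using hij))
    (fun i j hij => h' i j (by simpa using hij))

/-- Labels are immaterial, so only b * a⁻¹ matters. Keeping both a and b makes the moves symmetric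
in positions and slopes. -/
theorem permConfig_relabel (a b π : Equiv.Perm (Fin n)) :
    permConfig (a * π) (b * π) = permConfig a b := by
  ext1
  exact π.surjective.range_comp
    fun i => lineThrough ![((a i : ℕ) : ℝ), 0, 0] ![0, ((b i : ℕ) : ℝ), 1]

/-- Heights for a block of `k` elements: small and symmetric on the block, large outside. -/
noncomputable def blockHeight (n k m : ℕ) : ℝ :=
  if m < k then (2 * m + 1 - k) / (4 * n) else m + 1

theorem abs_blockHeight_le {n k m : ℕ} (hk : k ≤ n) (hm : m < k) :
    |blockHeight n k m| ≤ 1 / 4 := by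
  have h1 : (0 : ℝ) < n := by exact_mod_cast (by omega : 0 < n)
  have h2 : (k : ℝ) ≤ n := by exact_mod_cast hk
  have h3 : (m : ℝ) + 1 ≤ k := by exact_mod_cast hm
  have h4 : (0 : ℝ) ≤ m := Nat.cast_nonneg m
  rw [blockHeight, if_pos hm, abs_le, le_div_iff₀ (by positivity), div_le_iff₀ (by positivity)]
  constructor <;> linarith

theorem one_le_blockHeight {n k m : ℕ} (hm : ¬ m < k) : 1 ≤ blockHeight n k m := by
  rw [blockHeight, if_neg hm]
  have h4 : (0 : ℝ) ≤ m := Nat.cast_nonneg m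
  linarith

theorem strictMono_blockHeight {n k : ℕ} (hk : k ≤ n) : StrictMono (blockHeight n k) := by
  refine strictMono_nat_of_lt_succ fun m => ?_
  by_cases h1 : m + 1 < k
  · have hn : (0 : ℝ) < n := by exact_mod_cast (by omega : 0 < n)
    rw [blockHeight, blockHeight, if_pos h1, if_pos (by omega)]
    push_cast
    gcongr
    linarith
  · by_cases h2 : m < k
    · have := (abs_le.1 (abs_blockHeight_le hk h2)).2
      have h3 := one_le_blockHeight (n := n) h1
      linarith
    · rw [blockHeight, blockHeight, if_neg h1, if_neg h2]
      push_cast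
      linarith

theorem blockHeight_reverse {n k m m' : ℕ} (h : m' + m + 1 = k) :
    blockHeight n k m' = -blockHeight n k m := by
  rw [blockHeight, blockHeight, if_pos (by omega), if_pos (by omega), ← neg_div, ← h]
  push_cast
  ring

theorem permConfig_isotopic_blockHeight (a b : Equiv.Perm (Fin n)) {k : ℕ} (hk : k ≤ n) :
    Isotopic (permConfig a b) (stdConfig (injective_comp_perm (strictMono_blockHeight hk) a)
      (injective_comp_perm (strictMono_blockHeight hk) b)) :=
  permConfig_isotopic_stdConfig a b _ _ (fun _ _ h => strictMono_blockHeight hk h)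
    (fun _ _ h => strictMono_blockHeight hk h)

theorem permConfig_isotopic_of_block_swap {a b a' b' : Equiv.Perm (Fin n)} {k : ℕ} (hk : k ≤ n)
    (hS : ∀ i, (a i : ℕ) < k → (b i : ℕ) < k ∧ a' i = b i ∧ b' i = a i)
    (hout : ∀ i, ¬ (a i : ℕ) < k → ¬ (b i : ℕ) < k ∧ a' i = a i ∧ b' i = b i) :
    Isotopic (permConfig a b) (permConfig a' b') := by
  refine (permConfig_isotopic_blockHeight a b hk).trans
    (Isotopic.trans ?_ (permConfig_isotopic_blockHeight a' b' hk).symm)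
  refine stdConfig_isotopic_of_block_swap _ _ _ _ {i | (a i : ℕ) < k} (fun i hi => ?_)
    (fun i hi => ?_)
  · obtain ⟨h1, h2, h3⟩ := hS i hi
    exact ⟨abs_blockHeight_le hk hi, abs_blockHeight_le hk h1, by rw [h2], by rw [h3]⟩
  · obtain ⟨h1, h2, h3⟩ := hout i hi
    exact ⟨one_le_blockHeight hi, one_le_blockHeight h1, by rw [h2], by rw [h3]⟩

theorem permConfig_isotopic_of_block_rotation {a b a' b' : Equiv.Perm (Fin n)} {k : ℕ}
    (hk : k ≤ n) (hS : ∀ i, (a i : ℕ) < k →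
      (b i : ℕ) < k ∧ (a' i : ℕ) + a i + 1 = k ∧ (b' i : ℕ) + b i + 1 = k)
    (hout : ∀ i, ¬ (a i : ℕ) < k → ¬ (b i : ℕ) < k ∧ a' i = a i ∧ b' i = b i) :
    Isotopic (permConfig a b) (permConfig a' b') := by
  refine (permConfig_isotopic_blockHeight a b hk).trans
    (Isotopic.trans ?_ (permConfig_isotopic_blockHeight a' b' hk).symm)
  refine stdConfig_isotopic_of_block_rotation _ _ _ _ {i | (a i : ℕ) < k} (fun i hi => ?_)
    (fun i hi => ?_)
  · obtain ⟨h1, h2, h3⟩ := hS i hi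
    exact ⟨abs_blockHeight_le hk hi, abs_blockHeight_le hk h1, blockHeight_reverse h2,
      blockHeight_reverse h3⟩
  · obtain ⟨h1, h2, h3⟩ := hout i hi
    exact ⟨one_le_blockHeight hi, one_le_blockHeight h1, by rw [h2], by rw [h3]⟩

theorem permConfig_isotopic_swap (a b : Equiv.Perm (Fin n)) :
    Isotopic (permConfig a b) (permConfig b a) :=
  permConfig_isotopic_of_block_swap le_rfl (fun i _ => ⟨(b i).2, rfl, rfl⟩)
    (fun i hi => absurd (a i).2 hi)

/-- The angle whose tangent is the slope of the `m`-th of `n` equidistributed directions. -/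
noncomputable def slopeAngle (n m : ℕ) : ℝ := (m + 1 / 2) * (Real.pi / n) - Real.pi / 2

theorem slopeAngle_mem {n m : ℕ} (h : m < n) :
    slopeAngle n m ∈ Set.Ioo (-(Real.pi / 2)) (Real.pi / 2) := by
  have hn : (0 : ℝ) < n := by exact_mod_cast (by omega : 0 < n)
  have h1 : (m : ℝ) + 1 ≤ n := by exact_mod_cast h
  have h4 : (0 : ℝ) ≤ m := Nat.cast_nonneg m
  have hpi : 0 < Real.pi / n := div_pos Real.pi_pos hn
  have e : n * (Real.pi / n) = Real.pi := mul_div_cancel₀ _ hn.ne'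
  unfold slopeAngle
  constructor
  · nlinarith
  · nlinarith

theorem slopeAngle_lt {n m m' : ℕ} (hn : 0 < n) (h : m < m') :
    slopeAngle n m < slopeAngle n m' := by
  have hn : (0 : ℝ) < n := by exact_mod_cast hn
  have h1 : (m : ℝ) < m' := by exact_mod_cast h
  have hpi : 0 < Real.pi / n := div_pos Real.pi_pos hn
  unfold slopeAngle
  gcongr

theorem tan_slopeAngle_lt {n m m' : ℕ} (h : m < m') (h' : m' < n) :
    Real.tan (slopeAngle n m) < Real.tan (slopeAngle n m') :=
  Real.tan_lt_tan_of_lt_of_lt_pi_div_two (slopeAngle_mem (h.trans h')).1 (slopeAngle_mem h').2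
    (slopeAngle_lt (by omega) h)

theorem injective_tan_slopeAngle (a : Equiv.Perm (Fin n)) :
    Function.Injective fun i => Real.tan (slopeAngle n (a i)) := by
  intro i j hij
  by_contra hne
  rcases (a.injective.ne hne).lt_or_gt with h | h
  · exact (tan_slopeAngle_lt h (a j).2).ne hij
  · exact (tan_slopeAngle_lt h (a i).2).ne hij.symm

/-- With slopes tan of n equidistributed angles, rotation by c * π / n permutes the directions
cyclically. -/
theorem permConfig_isotopic_of_rotation (a : Equiv.Perm (Fin n)) {b b' : Equiv.Perm (Fin n)}
    {c : ℕ} (h : ∀ i, (b' i : ℕ) ≡ b i + c [MOD n]) :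
    Isotopic (permConfig a b) (permConfig a b') := by
  have hx := injective_comp_perm Nat.strictMono_cast a (X := fun m => (m : ℝ))
  refine (permConfig_isotopic_stdConfig a b hx (injective_tan_slopeAngle b)
    (fun i j hij => by simpa using hij) (fun i j hij => tan_slopeAngle_lt hij (b j).2)).trans
    (Isotopic.trans ?_ (permConfig_isotopic_stdConfig a b' hx (injective_tan_slopeAngle b')
    (fun i j hij => by simpa using hij) (fun i j hij => tan_slopeAngle_lt hij (b' j).2)).symm)
  -- Reduction modulo n costs a multiple of π in the angle, which does not change the tangent.
  have key : ∀ i, ∃ q : ℕ, slopeAngle n (b i) + c * (Real.pi / n) =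
      slopeAngle n (b' i) + q * Real.pi := by
    intro i
    have h1 := h i
    have hn : 0 < n := (Nat.zero_le _).trans_lt (b i).2
    refine ⟨(b i + c) / n, ?_⟩
    have h2 : (b i + c : ℕ) = (b' i : ℕ) + n * ((b i + c) / n) := by
      have h3 := Nat.mod_add_div (b i + c) n
      have h4 : (b i + c) % n = b' i := by rw [← h1, Nat.mod_eq_of_lt (b' i).2]
      omega
    have h5 : ((b i : ℕ) : ℝ) + c = (b' i : ℕ) + n * (((b i + c) / n : ℕ) : ℝ) := by
      exact_mod_cast h2
    have e : n * (Real.pi / n) = Real.pi := mul_div_cancel₀ _ (by positivity)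
    unfold slopeAngle
    linear_combination (Real.pi / n) * h5 + (((b i + c) / n : ℕ) : ℝ) * e
  refine stdConfig_isotopic_of_rotation _ _ _ (fun i => slopeAngle n (b i)) (c * (Real.pi / n))
    (fun i j hij => ?_) (fun i => ?_) (fun i => ?_) (fun i => rfl) (fun i => ?_)
  · have hi := slopeAngle_mem (b i).2
    have hj := slopeAngle_mem (b j).2
    have hn : 0 < n := (Nat.zero_le _).trans_lt (b i).2
    rcases (b.injective.ne hij).lt_or_gt with h1 | h1
    · have h2 := slopeAngle_lt hn h1
      refine (Real.sin_neg_of_neg_of_neg_pi_lt (sub_neg.2 h2) ?_).ne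
      linarith [hi.1, hj.2]
    · have h2 := slopeAngle_lt hn h1
      refine (Real.sin_pos_of_pos_of_lt_pi (sub_pos.2 h2) ?_).ne'
      linarith [hi.2, hj.1]
  · exact (Real.cos_pos_of_mem_Ioo (slopeAngle_mem (b i).2)).ne'
  · obtain ⟨q, hq⟩ := key i
    rw [hq, Real.cos_add_nat_mul_pi]
    exact mul_ne_zero (pow_ne_zero _ (by norm_num))
      (Real.cos_pos_of_mem_Ioo (slopeAngle_mem (b' i).2)).ne'
  · obtain ⟨q, hq⟩ := key i
    rw [hq, Real.tan_add_nat_mul_pi]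

end

/-! ### Spindles and their normal forms. -/

theorem mem_lineThrough_sup_lineThrough {p d q e r : R3} (h : q ∈ lineThrough p d) :
    r ∈ lineThrough p d ⊔ lineThrough q e ↔ ∃ a b : ℝ, r = q + a • d + b • e := by
  have hq := self_mem_lineThrough q e
  have hq' : q ∈ lineThrough p d ⊔ lineThrough q e :=
    (le_sup_right : lineThrough q e ≤ _) hq
  rw [← AffineSubspace.mk'_eq hq', AffineSubspace.mem_mk',
    AffineSubspace.direction_sup_eq_sup_direction h hq, direction_lineThrough,
    direction_lineThrough, Submodule.mem_sup]
  simp only [Submodule.mem_span_singleton, vsub_eq_sub]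
  constructor
  · rintro ⟨_, ⟨a, rfl⟩, _, ⟨b, rfl⟩, hr⟩
    exact ⟨a, b, by rw [add_assoc, hr]; abel⟩
  · rintro ⟨a, b, rfl⟩
    exact ⟨_, ⟨a, rfl⟩, _, ⟨b, rfl⟩, by abel⟩

theorem OrientedLine.toLine_eq (A : OrientedLine) (s : ℝ) :
    A.toLine = lineThrough (A.point s) (A.ω - A.α) := by
  simpa [OrientedLine.toLine, OrientedLine.point] using
    (lineThrough_add_smul A.α (A.ω - A.α) one_ne_zero s).symm

theorem OrientedLine.lk_eq (A B : OrientedLine) :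
    A.lk B = SignType.sign (-vol (A.ω - A.α) (B.ω - B.α) (B.α - A.α)) := by
  rw [OrientedLine.lk, det_of_eq_vol]
  congr 1
  simp [vol]; ring

theorem exists_isSpindleWith {n : ℕ} (σ : Equiv.Perm (Fin n)) :
    IsSpindleWith (permConfig 1 σ) σ := by
  let A : OrientedLine := ⟨0, ![1, 0, 0], fun h => by simpa using congrFun h 0⟩
  let B : OrientedLine := ⟨![0, 0, 1], ![0, 1, 1], fun h => by simpa using congrFun h 1⟩
  have hA : ∀ s, A.point s = ![s, 0, 0] := by
    intro s
    ext k
    fin_cases k <;> simp [A, OrientedLine.point]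
  have hB : ∀ s, B.point s = ![0, s, 1] := by
    intro s
    ext k
    fin_cases k <;> simp [B, OrientedLine.point]
  refine ⟨A, B, fun i => lineThrough ![((i : ℕ) : ℝ), 0, 0] ![0, ((σ i : ℕ) : ℝ), 1],
    fun i => (i : ℕ), fun i => (σ i : ℕ), rfl, ?_, ?_, ?_, ?_, ?_⟩
  · exact Nat.strictMono_cast.comp Fin.val_strictMono
  · intro i
    rw [hA]
    exact self_mem_lineThrough _ _
  · rw [OrientedLine.lk_eq]
    simp [A, B, vol]
  · intro i s
    rw [A.toLine_eq (i : ℕ), mem_lineThrough_sup_lineThrough (hA (i : ℕ) ▸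
      self_mem_lineThrough _ _), hA, hB]
    constructor
    · rintro ⟨a, b, h⟩
      have h1 := congrFun h 1
      have h2 := congrFun h 2
      simp [A] at h1 h2
      rw [h1, ← h2, one_mul]
    · rintro rfl
      refine ⟨1, -(i : ℕ), ?_⟩
      ext k
      fin_cases k <;> simp [A]
  · intro i j
    simp

/-- Let u and w be the directions of axis and directrix, and m = B.α - A.α. The i-th line passes
through A.α + x i • u with direction m + y i • w + β i • u. Deforming u, w, m to the standard basis,
x and y to ranks, and A.α and β to 0 gives the normal form. -/
theorem IsSpindleWith.isotopic {n : ℕ} {C : SkewConfiguration n} {σ : Equiv.Perm (Fin n)}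
    (h : IsSpindleWith C σ) : Isotopic C (permConfig 1 σ) := by
  obtain ⟨A, B, L, x, y, hC, hx, hA, hlk, hB, hσ⟩ := h
  set u := A.ω - A.α with hu
  set w := B.ω - B.α with hw
  set m := B.α - A.α with hm
  have hvol : 0 < vol u w m := by
    rw [OrientedLine.lk_eq, sign_eq_neg_one_iff] at hlk
    exact neg_neg_iff_pos.1 hlk
  have hL : ∀ i, ∃ β : ℝ, L i = lineThrough (A.α + x i • u) (m + y i • w + β • u) := by
    intro i
    obtain ⟨p, d, hd, hpd⟩ := C.isLine (L i) (hC ▸ ⟨i, rfl⟩)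
    have h1 : A.point (x i) ∈ lineThrough p d := hpd ▸ hA i
    obtain ⟨c, hc⟩ := mem_lineThrough.1 h1
    have h2 := (hB i (y i)).2 rfl
    rw [hpd, A.toLine_eq (x i), mem_lineThrough_sup_lineThrough h1] at h2
    obtain ⟨a, b, hab⟩ := h2
    have hab' : m + y i • w = x i • u + a • d + b • u := by
      have : m + y i • w = B.point (y i) - A.α := by
        simp only [OrientedLine.point, hm, hw]; abel
      rw [this, hab]
      simp only [OrientedLine.point, hu]; abel
    -- Otherwise the directrix would meet the axis.
    have ha : a ≠ 0 := by
      rintro rfl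
      have : vol u w m = vol u w (m + y i • w) := by simp [vol]; ring
      rw [this, hab'] at hvol
      have h0 : vol u w (x i • u + (0 : ℝ) • d + b • u) = 0 := by simp [vol]; ring
      exact hvol.ne' h0
    refine ⟨-(x i + b), ?_⟩
    have e1 : m + y i • w + -(x i + b) • u = a • d := by rw [hab']; module
    have e2 : A.α + x i • u = p + c • d := hc
    rw [e1, e2, lineThrough_add_smul _ _ ha, hpd]
  choose β hβ using hL
  have hy : ∀ i j, σ i < σ j → y i < y j := fun i j => (hσ i j).1
  have hyi : Function.Injective y := by
    intro i j hij
    by_contra hne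
    rcases (σ.injective.ne hne).lt_or_gt with h | h
    · exact (hy i j h).ne hij
    · exact (hy j i h).ne hij.symm
  obtain ⟨U, W, M, cU, cW, cM, hv, U0, W0, M0, U1, W1, M1⟩ := exists_path_of_vol_pos hvol
  have hx' : ∀ i j : Fin n, x i < x j → ((i : ℕ) : ℝ) < ((j : ℕ) : ℝ) := fun i j hij => by
    simpa using hx.lt_iff_lt.1 hij
  have hy' : ∀ i j, y i < y j → ((σ i : ℕ) : ℝ) < ((σ j : ℕ) : ℝ) := fun i j hij => by
    simpa using (hσ i j).2 hij
  refine isotopic_of_path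
    (fun i t => (1 - (t : ℝ)) • A.α + ((1 - (t : ℝ)) * x i + t * (i : ℕ)) • U t)
    (fun i t => M t + ((1 - (t : ℝ)) * y i + t * (σ i : ℕ)) • W t + ((1 - (t : ℝ)) * β i) • U t)
    (fun i => by fun_prop) (fun i => by fun_prop) (fun t => ⟨fun i h0 => ?_, fun i j hij => ?_⟩)
    ?_ ?_
  · apply hv t
    have : vol (U t) (W t) (M t) = vol (U t) (W t)
      (M t + ((1 - (t : ℝ)) * y i + t * (σ i : ℕ)) • W t + ((1 - (t : ℝ)) * β i) • U t) := by
      simp [vol]; ring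
    rw [this, h0]
    simp [vol]
  -- The determinant is (difference of x) * (difference of y) * vol (U t) (W t) (M t); the β-terms
  -- cancel.
  · have e1 := (injective_interpolation hx.injective hx' t.2).ne hij
    have e2 := (injective_interpolation hyi hy' t.2).ne hij
    have e3 := mul_ne_zero (mul_ne_zero (sub_ne_zero.2 e1) (sub_ne_zero.2 e2)) (hv t)
    convert e3 using 1
    simp [vol]; ring
  · rw [hC]
    congr 1
    ext1 i
    rw [hβ]
    simp [U0, W0, M0]
  · simp only [permConfig, stdConfig, IsSkewFrame.config]
    congr 1
    ext1 i
    congr 1 <;> ext k <;> fin_cases k <;> simp [U1, W1, M1]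

/-! ### The spindle moves as isotopies. -/

section

variable {n : ℕ}

/-- Exchanging positions and slopes turns a cyclic shift along the axis into a rotation of
directions. -/
theorem permConfig_isotopic_of_axis_rotation {a a' : Equiv.Perm (Fin n)} (b : Equiv.Perm (Fin n))
    {c : ℕ} (h : ∀ i, (a' i : ℕ) ≡ a i + c [MOD n]) :
    Isotopic (permConfig a b) (permConfig a' b) :=
  (permConfig_isotopic_swap a b).trans
    ((permConfig_isotopic_of_rotation b h).trans (permConfig_isotopic_swap b a'))

theorem permConfig_isotopic_of_mul_inv_eq {a b a' b' : Equiv.Perm (Fin n)}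
    (h : b * a⁻¹ = b' * a'⁻¹) : permConfig a b = permConfig a' b' := by
  rw [← permConfig_relabel a b a⁻¹, ← permConfig_relabel a' b' a'⁻¹, h, mul_inv_cancel,
    mul_inv_cancel]

theorem CircularMove.isotopic {σ μ : Equiv.Perm (Fin n)} (h : CircularMove σ μ) :
    Isotopic (permConfig 1 σ) (permConfig 1 μ) := by
  obtain ⟨s, t, hs, -, h⟩ := h
  have : NeZero n := ⟨by omega⟩
  let ρ : Equiv.Perm (Fin n) := Equiv.addRight (Fin.ofNat n t)
  have hρ : ∀ i, (ρ i : ℕ) ≡ i + t [MOD n] := by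
    intro i
    simp [ρ, Fin.val_add, Fin.ofNat, Nat.ModEq]
  have h1 : Isotopic (permConfig 1 σ) (permConfig ρ⁻¹ σ) := by
    refine (permConfig_isotopic_of_axis_rotation (c := t) σ fun i => ?_).symm
    simpa using hρ (ρ⁻¹ i)
  have h2 : permConfig ρ⁻¹ σ = permConfig 1 (σ * ρ) :=
    permConfig_isotopic_of_mul_inv_eq (by simp)
  rw [h2] at h1
  refine h1.trans (permConfig_isotopic_of_rotation (c := s) 1 fun i => ?_)
  have := h i (ρ i) (hρ i)
  rwa [add_comm] at this

/-- The permutation reversing the first `k` elements. -/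
def blockReverse (k : ℕ) (hk : k ≤ n) : Equiv.Perm (Fin n) :=
  Function.Involutive.toPerm
    (fun i => if h : (i : ℕ) < k then ⟨k - 1 - i, by omega⟩ else i) fun i => by
      by_cases h : (i : ℕ) < k
      · have : k - 1 - (i : ℕ) < k := by omega
        ext
        simp only [h, dif_pos, this]
        omega
      · simp [h]

theorem blockReverse_add {k : ℕ} (hk : k ≤ n) {i : Fin n} (h : (i : ℕ) < k) :
    (blockReverse k hk i : ℕ) + i + 1 = k := by
  have e : blockReverse k hk i = if h : (i : ℕ) < k then ⟨k - 1 - i, by omega⟩ else i := rfl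
  rw [e, dif_pos h]
  simp only
  omega

theorem blockReverse_of_not_lt {k : ℕ} (hk : k ≤ n) {i : Fin n} (h : ¬ (i : ℕ) < k) :
    blockReverse k hk i = i := by
  have e : blockReverse k hk i = if h : (i : ℕ) < k then ⟨k - 1 - i, by omega⟩ else i := rfl
  rw [e, dif_neg h]

/-- A permutation mapping a finite set into itself maps it onto itself, hence preserves the
complement. -/
theorem not_lt_of_block {σ : Equiv.Perm (Fin n)} {k : ℕ}
    (h : ∀ i : Fin n, (i : ℕ) < k → (σ i : ℕ) < k) {i : Fin n} (hi : ¬ (i : ℕ) < k) :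
    ¬ (σ i : ℕ) < k := by
  intro hc
  let S : Finset (Fin n) := Finset.univ.filter fun i => (i : ℕ) < k
  have h1 : S.image σ ⊆ S := by
    intro j hj
    obtain ⟨i, hi, rfl⟩ := Finset.mem_image.1 hj
    simpa [S] using h i (by simpa [S] using hi)
  have h2 : S.image σ = S :=
    Finset.eq_of_subset_of_card_le h1 (Finset.card_image_of_injective _ σ.injective).ge
  have h3 : σ i ∈ S.image σ := by rw [h2]; simpa [S] using hc
  obtain ⟨j, hj, hji⟩ := Finset.mem_image.1 h3
  rw [σ.injective hji] at hj
  exact hi (by simpa [S] using hj)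

theorem VerticalReflection.isotopic {σ μ : Equiv.Perm (Fin n)} (h : VerticalReflection σ μ) :
    Isotopic (permConfig 1 σ) (permConfig 1 μ) := by
  obtain ⟨k, hk, h1, h2, h3⟩ := h
  have h4 : permConfig 1 μ = permConfig (blockReverse k hk) (μ * blockReverse k hk) :=
    permConfig_isotopic_of_mul_inv_eq (by simp)
  rw [h4]
  refine permConfig_isotopic_of_block_rotation hk (fun i hi => ⟨h1 i hi, ?_, ?_⟩)
    (fun i hi => ⟨not_lt_of_block h1 hi, ?_, ?_⟩)
  · exact blockReverse_add hk hi
  · exact h2 _ i (blockReverse_add hk hi)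
  · exact blockReverse_of_not_lt hk hi
  · have e : blockReverse k hk i = i := blockReverse_of_not_lt hk hi
    rw [Equiv.Perm.mul_apply, e]
    exact h3 i (not_lt.1 hi)

theorem HorizontalReflection.isotopic {σ μ : Equiv.Perm (Fin n)} (h : HorizontalReflection σ μ) :
    Isotopic (permConfig 1 σ) (permConfig 1 μ) := by
  obtain ⟨k, hk, h1, h2, h3⟩ := h
  have hμ : ∀ i : Fin n, (i : ℕ) < k → μ (σ i) = i := fun i hi => by
    rw [h2 _ (h1 i hi)]; simp
  have hinj : Function.Injective fun i : Fin n => if (i : ℕ) < k then σ i else i := by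
    intro i j hij
    by_cases hi : (i : ℕ) < k <;> by_cases hj : (j : ℕ) < k <;> simp only [hi, hj, if_true,
      if_false] at hij
    · exact σ.injective hij
    · exact absurd (hij ▸ h1 i hi) hj
    · exact absurd (hij ▸ h1 j hj) hi
    · exact hij
  -- Relabelled by a, the pair (1, μ) has first order σ and second order the identity on the block:
  -- it is (1, σ) with the two orders exchanged there.
  let a : Equiv.Perm (Fin n) := Equiv.ofBijective _ (Finite.injective_iff_bijective.1 hinj)
  have ha : ∀ i, a i = if (i : ℕ) < k then σ i else i := fun _ => rfl
  have h4 : permConfig 1 μ = permConfig a (μ * a) :=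
    permConfig_isotopic_of_mul_inv_eq (by simp)
  rw [h4]
  refine permConfig_isotopic_of_block_swap hk (fun i hi => ?_) (fun i hi => ?_)
  · have hi' : (i : ℕ) < k := hi
    refine ⟨h1 i hi, by simp [ha, hi'], by simp [ha, hi', hμ i hi']⟩
  · have hi' : ¬ (i : ℕ) < k := hi
    exact ⟨not_lt_of_block h1 hi, by simp [ha, hi'], by simp [ha, hi', h3 i (not_lt.1 hi')]⟩

theorem SpindleEquivalent.isotopic {σ μ : Equiv.Perm (Fin n)} (h : SpindleEquivalent σ μ) :
    Isotopic (permConfig 1 σ) (permConfig 1 μ) := by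
  induction h with
  | rel σ μ h =>
    rcases h with h | h | h
    · exact h.isotopic
    · exact h.isotopic
    · exact h.isotopic
  | refl σ => exact Isotopic.refl _
  | symm σ μ _ ih => exact ih.symm
  | trans σ μ ν _ _ ih ih' => exact ih.trans ih'

/-- The linking signs of isotopic standard spindles agree up to relabelling and switching. -/
theorem exists_switching_of_permConfig_isotopic {σ σ' : Equiv.Perm (Fin n)}
    (h : Isotopic (permConfig 1 σ) (permConfig 1 σ')) :
    ∃ (π : Equiv.Perm (Fin n)) (l : Fin n → ℝ), (∀ i, l i ≠ 0) ∧ ∀ i j, i ≠ j →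
      0 < l i * l j * ((((i : ℕ) : ℝ) - (j : ℕ)) * (((σ i : ℕ) : ℝ) - (σ j : ℕ))) *
        ((((π i : ℕ) : ℝ) - (π j : ℕ)) * (((σ' (π i) : ℕ) : ℝ) - (σ' (π j) : ℕ))) := by
  obtain ⟨π, l, hl, hp⟩ := Isotopic.exists_switching
    (isSkewFrame_std (injective_comp_perm Nat.strictMono_cast 1)
      (injective_comp_perm Nat.strictMono_cast σ))
    (isSkewFrame_std (injective_comp_perm Nat.strictMono_cast 1)
      (injective_comp_perm Nat.strictMono_cast σ')) h
  refine ⟨π, l, hl, fun i j hij => ?_⟩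
  have e : ∀ a b c d : ℝ, vol ![0, b, 1] ![0, d, 1] (![a, 0, 0] - ![c, 0, 0]) =
      (a - c) * (b - d) := by
    intro a b c d
    simp [vol]; ring
  have := hp i j hij
  simp only [e] at this
  exact this

end

/-! ### Gallai's theorem on three-colourings without rainbow triangles. -/

section Connectivity

variable {V : Type*}

/-- `x` and `y` are joined by a `Q`-path inside `S`. -/
def JoinedWithin (Q : V → V → Prop) (S : Set V) : V → V → Prop :=
  Relation.ReflTransGen fun x y => x ∈ S ∧ y ∈ S ∧ Q x y

/-- `S` is connected for the graph `Q`. -/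
def ConnectedOn (Q : V → V → Prop) (S : Set V) : Prop :=
  ∀ x ∈ S, ∀ y ∈ S, JoinedWithin Q S x y

variable {Q Q' : V → V → Prop} {S : Set V} {x y z : V}

theorem JoinedWithin.mem (h : JoinedWithin Q S x y) (hx : x ∈ S) : y ∈ S := by
  induction h with
  | refl => exact hx
  | tail _ h _ => exact h.2.1

theorem JoinedWithin.symm (hQ : ∀ x y, Q x y → Q y x) (h : JoinedWithin Q S x y) :
    JoinedWithin Q S y x := by
  induction h with
  | refl => exact .refl
  | tail _ h ih => exact .head ⟨h.2.1, h.1, hQ _ _ h.2.2⟩ ih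

theorem JoinedWithin.trans (h : JoinedWithin Q S x y) (h' : JoinedWithin Q S y z) :
    JoinedWithin Q S x z :=
  Relation.ReflTransGen.trans h h'

theorem JoinedWithin.single (hx : x ∈ S) (hy : y ∈ S) (h : Q x y) : JoinedWithin Q S x y :=
  Relation.ReflTransGen.single ⟨hx, hy, h⟩

theorem ConnectedOn.mono (h : ∀ x ∈ S, ∀ y ∈ S, Q x y → Q' x y) (hc : ConnectedOn Q S) :
    ConnectedOn Q' S := fun x hx y hy =>
  Relation.ReflTransGen.mono (fun a b hab => ⟨hab.1, hab.2.1, h a hab.1 b hab.2.1 hab.2.2⟩) _ _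
    (hc x hx y hy)

/-- In a colouring of a complete graph by three colours without rainbow triangles, some colour
class is disconnected. -/
theorem exists_not_connectedOn_of_no_rainbow (c : V → V → Fin 3) (hc : ∀ x y, c x y = c y x)
    (hr : ∀ x y z, x ≠ y → y ≠ z → x ≠ z → c x y = c y z ∨ c y z = c x z ∨ c x y = c x z)
    (m : ℕ) : ∀ S : Set V, S.Finite → S.ncard = m → S.Nontrivial →
      ∃ k, ¬ ConnectedOn (fun x y => x ≠ y ∧ c x y = k) S := by
  induction m using Nat.strong_induction_on with
  | _ m ih =>
  intro S hfin hm hS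
  by_contra! hcon
  obtain ⟨v, hv⟩ := hS.nonempty
  have hw : ∀ k, ∃ w ∈ S \ {v}, c v w = k := by
    intro k
    obtain ⟨y, hy, hyv⟩ := hS.exists_ne v
    rcases Relation.ReflTransGen.cases_head (hcon k v hv y hy) with h | ⟨w, hw, -⟩
    · exact absurd h.symm hyv
    · exact ⟨w, ⟨hw.2.1, fun e => hw.2.2.1 e.symm⟩, hw.2.2.2⟩
  choose w hwS hwc using hw
  have hS' : (S \ {v}).Nontrivial :=
    ⟨w 0, hwS 0, w 1, hwS 1, fun e => by have h0 := hwc 0; rw [e, hwc 1] at h0; simp at h0⟩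
  obtain ⟨k, hk⟩ := ih (S \ {v}).ncard (hm ▸ Set.ncard_sdiff_singleton_lt_of_mem hv hfin) (S \ {v})
    (hfin.subset Set.sdiff_subset) rfl hS'
  set T := S \ {v} with hT
  set J := JoinedWithin (fun x y => x ≠ y ∧ c x y = k) T with hJ
  have hsymm : ∀ x y, J x y → J y x := fun x y h =>
    JoinedWithin.symm (fun x y h => ⟨h.1.symm, by rw [hc, h.2]⟩) h
  -- Every k-component J of T contains a k-coloured neighbour of v: follow a k-path in S towards v
  -- and stop just before it.
  have hnb : ∀ x ∈ T, ∃ x' ∈ T, J x x' ∧ c v x' = k := by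
    intro x hx
    have : ∀ y, JoinedWithin (fun x y => x ≠ y ∧ c x y = k) S y v → y ∈ T →
        ∃ x' ∈ T, J y x' ∧ c v x' = k := by
      intro y hy
      induction hy using Relation.ReflTransGen.head_induction_on with
      | refl => exact fun h => absurd rfl h.2
      | @head p q h _ ih =>
        intro hp
        by_cases hq : q = v
        · subst hq
          exact ⟨p, hp, .refl, by rw [hc]; exact h.2.2.2⟩
        · obtain ⟨x', h1, h2, h3⟩ := ih ⟨h.2.1, hq⟩
          exact ⟨x', h1, Relation.ReflTransGen.head ⟨hp, ⟨h.2.1, hq⟩, h.2.2⟩ h2, h3⟩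
    exact this x (hcon k x hx.1 v hv) hx
  have hne : ∀ x ∈ T, ∀ y ∈ T, ¬ J x y → x ≠ y ∧ c x y ≠ k := by
    intro x hx y hy h
    have hxy : x ≠ y := by rintro rfl; exact h .refl
    exact ⟨hxy, fun e => h (Relation.ReflTransGen.single ⟨hx, hy, hxy, e⟩)⟩
  -- A point outside a k-component sees the whole component in one colour: along a k-edge, two
  -- different colours other than k would give a rainbow triangle.
  have hhom : ∀ z z', J z z' → z ∈ T → ∀ y ∈ T, ¬ J z y → c z y = c z' y := by
    intro z z' h hz y hy hzy
    induction h with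
    | refl => rfl
    | @tail p q hp hpq ih =>
      rw [ih]
      have h1 : ¬ J p y := fun h => hzy (hp.trans h)
      have h2 : ¬ J q y := fun h => hzy ((hp.tail hpq).trans h)
      obtain ⟨e1, e2⟩ := hne p hpq.1 y hy h1
      obtain ⟨e3, e4⟩ := hne q hpq.2.1 y hy h2
      rcases hr p q y hpq.2.2.1 e3 e1 with h | h | h
      · exact absurd (h.symm.trans hpq.2.2.2) e4
      · exact h.symm
      · exact absurd (h.symm.trans hpq.2.2.2) e2
  -- In the triangle v, w l, y, two edges have colours l and k, and the third is not k because y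
  -- lies in another k-component.
  have hcol : ∀ l, l ≠ k → ∀ y ∈ T, c v y = k → ¬ J (w l) y → c (w l) y = l := by
    intro l hl y hy hvy h
    obtain ⟨e1, e2⟩ := hne _ (hwS l) y hy h
    rcases hr v (w l) y (fun e => (hwS l).2 e.symm) e1 (fun e => hy.2 e.symm) with h | h | h
    · rw [← h, hwc]
    · exact absurd (h.trans hvy) e2
    · exact absurd ((hwc l).symm.trans (h.trans hvy)) hl
  obtain ⟨l, m', hl, hm', hlm⟩ : ∃ l m' : Fin 3, l ≠ k ∧ m' ≠ k ∧ l ≠ m' :=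
    (by decide : ∀ k : Fin 3, ∃ l m' : Fin 3, l ≠ k ∧ m' ≠ k ∧ l ≠ m') k
  -- If w l and w m' share a k-component, a k-neighbour of v in another component sees it in both
  -- colours l and m'. If not, the edges between their two components would all have colour l and
  -- also colour m'.
  by_cases hz : J (w l) (w m')
  · have : ∃ x ∈ T, ¬ J (w l) x := by
      by_contra! h
      exact hk fun x hx y hy => (hsymm _ _ (h x hx)).trans (h y hy)
    obtain ⟨x, hx, hlx⟩ := this
    obtain ⟨x', hx', hxx', hvx'⟩ := hnb x hx
    have h1 : ¬ J (w l) x' := fun h => hlx (h.trans (hsymm _ _ hxx'))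
    have h2 : ¬ J (w m') x' := fun h => h1 (hz.trans h)
    apply hlm
    rw [← hcol l hl x' hx' hvx' h1, ← hcol m' hm' x' hx' hvx' h2]
    exact hhom _ _ hz (hwS l) x' hx' h1
  · obtain ⟨z, hzT, hz1, hz2⟩ := hnb _ (hwS l)
    obtain ⟨z', hzT', hz1', hz2'⟩ := hnb _ (hwS m')
    have h1 : ¬ J (w l) z' := fun h => hz (h.trans (hsymm _ _ hz1'))
    have h2 : ¬ J (w m') z := fun h => hz (hz1.trans (hsymm _ _ h))
    apply hlm
    rw [← hcol l hl z' hzT' hz2' h1, ← hcol m' hm' z hzT hz2 h2, hhom _ _ hz1 (hwS l) z' hzT' h1,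
      hhom _ _ hz1' (hwS m') z hzT h2, hc]

end Connectivity

/-! ### Transitive orientations of an inversion graph. -/

/-- Two pairs of linear orders on `V`, given by injective functions, with the same graph of
inversions. -/
structure OrderPairs (V : Type*) where
  a : V → ℤ
  b : V → ℤ
  a' : V → ℤ
  b' : V → ℤ
  a_inj : Function.Injective a
  b_inj : Function.Injective b
  a'_inj : Function.Injective a'
  b'_inj : Function.Injective b'
  same : ∀ i j, i ≠ j → ((a i < a j ↔ b i < b j) ↔ (a' i < a' j ↔ b' i < b' j))

/-- `I` is an interval for the order defined by `a`. -/
def IsIntervalFor {V α : Type*} [LT α] (I : Set V) (a : V → α) : Prop :=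
  ∀ u ∈ I, ∀ w ∈ I, ∀ v, a u < a v → a v < a w → v ∈ I

namespace OrderPairs

variable {V : Type*} (X : OrderPairs V)

/-- The two first orders of both pairs disagree on `i`, `j`. -/
def Disagree (i j : V) : Prop := ¬ (X.a i < X.a j ↔ X.a' i < X.a' j)

/-- Pairs that are not inversions. -/
def NonInv (i j : V) : Prop := i ≠ j ∧ (X.a i < X.a j ↔ X.b i < X.b j)

/-- Inversions on which both pairs of orders disagree. -/
def DisInv (i j : V) : Prop :=
  i ≠ j ∧ ¬ (X.a i < X.a j ↔ X.b i < X.b j) ∧ ¬ (X.a i < X.a j ↔ X.a' i < X.a' j)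

/-- Inversions on which both pairs of orders agree. -/
def AgreeInv (i j : V) : Prop :=
  i ≠ j ∧ ¬ (X.a i < X.a j ↔ X.b i < X.b j) ∧ (X.a i < X.a j ↔ X.a' i < X.a' j)

/-- A common interval of the two orders `a` and `b`. -/
def IsBlock (I : Set V) : Prop := IsIntervalFor I X.a ∧ IsIntervalFor I X.b

theorem lt_asymm_a {i j : V} (h : i ≠ j) : X.a i < X.a j ↔ ¬ X.a j < X.a i := by
  have := X.a_inj.ne h; omega

theorem lt_asymm_b {i j : V} (h : i ≠ j) : X.b i < X.b j ↔ ¬ X.b j < X.b i := by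
  have := X.b_inj.ne h; omega

theorem lt_asymm_a' {i j : V} (h : i ≠ j) : X.a' i < X.a' j ↔ ¬ X.a' j < X.a' i := by
  have := X.a'_inj.ne h; omega

theorem lt_asymm_b' {i j : V} (h : i ≠ j) : X.b' i < X.b' j ↔ ¬ X.b' j < X.b' i := by
  have := X.b'_inj.ne h; omega

theorem NonInv.symm {i j : V} (h : X.NonInv i j) : X.NonInv j i := by
  obtain ⟨h1, h2⟩ := h
  have := X.lt_asymm_a h1
  have := X.lt_asymm_b h1
  exact ⟨h1.symm, by tauto⟩

theorem DisInv.symm {i j : V} (h : X.DisInv i j) : X.DisInv j i := by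
  obtain ⟨h1, h2, h3⟩ := h
  have := X.lt_asymm_a h1
  have := X.lt_asymm_b h1
  have := X.lt_asymm_a' h1
  exact ⟨h1.symm, by tauto, by tauto⟩

theorem AgreeInv.symm {i j : V} (h : X.AgreeInv i j) : X.AgreeInv j i := by
  obtain ⟨h1, h2, h3⟩ := h
  have := X.lt_asymm_a h1
  have := X.lt_asymm_b h1
  have := X.lt_asymm_a' h1
  exact ⟨h1.symm, by tauto, by tauto⟩

theorem trichotomy {i j : V} (h : i ≠ j) : X.NonInv i j ∨ X.DisInv i j ∨ X.AgreeInv i j := by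
  unfold NonInv DisInv AgreeInv; tauto

/-- Exchanging the two orders of both pairs. -/
def swap : OrderPairs V :=
  ⟨X.b, X.a, X.b', X.a', X.b_inj, X.a_inj, X.b'_inj, X.a'_inj, fun i j h => by
    have := X.same i j h; tauto⟩

/-- Reversing the second order of both pairs. -/
def mirror : OrderPairs V :=
  ⟨X.a, fun i => -X.b i, X.a', fun i => -X.b' i, X.a_inj, neg_injective.comp X.b_inj, X.a'_inj,
    neg_injective.comp X.b'_inj, fun i j h => by
      have h1 := X.same i j h
      have h2 := X.lt_asymm_b h
      have h3 := X.lt_asymm_b' h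
      simp only [neg_lt_neg_iff]
      tauto⟩

theorem swap_disInv {i j : V} : X.swap.DisInv i j ↔ X.DisInv i j := by
  unfold DisInv swap
  simp only
  by_cases h : i = j
  · simp [h]
  · have := X.same i j h; tauto

theorem swap_nonInv {i j : V} : X.swap.NonInv i j ↔ X.NonInv i j := by
  unfold NonInv swap
  simp only
  tauto

/-- At least one of p v and v q is an inversion. If both are, agreement on both would give agreement
on p q by transitivity. If only one is, the non-inversion forces the other pair of orders to reverse
it together with p q. -/
theorem disInv_of_between {p v q : V} (h1 : X.a p < X.a v) (h2 : X.a v < X.a q)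
    (h : X.DisInv p q) : X.DisInv p v ∨ X.DisInv v q := by
  obtain ⟨hpq, h3, h4⟩ := h
  have hpv : p ≠ v := by rintro rfl; exact lt_irrefl _ h1
  have hvq : v ≠ q := by rintro rfl; exact lt_irrefl _ h2
  have e1 := X.same p q hpq
  have e2 := X.same p v hpv
  have e3 := X.same v q hvq
  have n1 := X.b_inj.ne hpv
  have n2 := X.b_inj.ne hvq
  have n3 := X.a'_inj.ne hpv
  have n4 := X.a'_inj.ne hvq
  have n5 := X.b'_inj.ne hpv
  have n6 := X.b'_inj.ne hvq
  have n7 := X.b'_inj.ne hpq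
  have n8 := X.a'_inj.ne hpq
  have n9 := X.b_inj.ne hpq
  unfold DisInv
  grind

theorem nonInv_of_between {p v q : V} (h1 : X.a p < X.a v) (h2 : X.a v < X.a q)
    (h : X.NonInv p q) : X.NonInv p v ∨ X.NonInv v q := by
  obtain ⟨hpq, h3⟩ := h
  have hpv : p ≠ v := by rintro rfl; exact lt_irrefl _ h1
  have hvq : v ≠ q := by rintro rfl; exact lt_irrefl _ h2
  have n1 := X.b_inj.ne hpv
  have n2 := X.b_inj.ne hvq
  have n9 := X.b_inj.ne hpq
  unfold NonInv
  grind

/-- There is no triangle formed by an agreeing inversion, a disagreeing one and a non-inversion. -/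
theorem not_nonInv_of_agreeInv_of_disInv {x y z : V} (h : X.AgreeInv x y) (h' : X.DisInv y z) :
    ¬ X.NonInv x z := by
  -- If x z is not an inversion, then in the first order of either pair y lies above both x and z or
  -- below both, since otherwise transitivity would invert x z. So agreement on x y forces agreement
  -- on y z.
  rintro ⟨hxz, h5⟩
  obtain ⟨hxy, h1, h2⟩ := h
  obtain ⟨hyz, h3, h4⟩ := h'
  have e1 := X.same x y hxy
  have e2 := X.same y z hyz
  have e3 := X.same x z hxz
  have n1 := X.a_inj.ne hxy
  have n2 := X.a_inj.ne hyz
  have n3 := X.a_inj.ne hxz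
  have n4 := X.b_inj.ne hxy
  have n5 := X.b_inj.ne hyz
  have n6 := X.b_inj.ne hxz
  have n7 := X.a'_inj.ne hxy
  have n8 := X.a'_inj.ne hyz
  have n9 := X.a'_inj.ne hxz
  have m1 := X.b'_inj.ne hxy
  have m2 := X.b'_inj.ne hyz
  have m3 := X.b'_inj.ne hxz
  grind

end OrderPairs

/-- If every element between two adjacent elements of a graph is adjacent to one of them, then
connected components are intervals. -/
theorem isIntervalFor_component {V : Type*} {Q : V → V → Prop} (hQ : ∀ x y, Q x y → Q y x)
    {a : V → ℤ} (ha : Function.Injective a)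
    (hb : ∀ p v q, a p < a v → a v < a q → Q p q → Q p v ∨ Q v q) {I : Set V}
    (hI : IsIntervalFor I a) {x : V} (hx : x ∈ I) :
    IsIntervalFor {y | JoinedWithin Q I x y} a := by
  intro u hu w hw v huv hvw
  have hu' : JoinedWithin Q I x u := hu
  have hw' : JoinedWithin Q I x w := hw
  have hv : v ∈ I := hI u (hu'.mem hx) w (hw'.mem hx) v huv hvw
  by_contra hxv
  have hxv' : ¬ JoinedWithin Q I x v := hxv
  -- A path starting below v cannot jump over v: by `hb`, v would be adjacent to an end of the
  -- jumping edge and so belong to the component.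
  have key : ∀ y, JoinedWithin Q I u y → a y < a v := by
    intro y hy
    induction hy with
    | refl => exact huv
    | @tail p q hp hpq ih =>
      by_contra hlt
      have hxp := hu'.trans hp
      have hxq := hxp.tail hpq
      have hne : v ≠ q := by rintro rfl; exact hxv' hxq
      have hlt' : a v < a q := by have := ha.ne hne; omega
      rcases hb p v q ih hlt' hpq.2.2 with h | h
      · exact hxv' (hxp.tail ⟨hpq.1, hv, h⟩)
      · exact hxv' (hxq.tail ⟨hpq.2.1, hv, hQ _ _ h⟩)
  have := key w ((hu'.symm hQ).trans hw')
  omega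

namespace OrderPairs

variable {V : Type*} (X : OrderPairs V)

theorem isBlock_disInv_component {I : Set V} (hI : X.IsBlock I) {x : V} (hx : x ∈ I) :
    X.IsBlock {y | JoinedWithin X.DisInv I x y} :=
  ⟨isIntervalFor_component (Q := X.DisInv) (fun _ _ h => h.symm) X.a_inj
      (fun _ _ _ h1 h2 h => X.disInv_of_between h1 h2 h) hI.1 hx,
    isIntervalFor_component (Q := X.DisInv) (fun _ _ h => h.symm) X.b_inj (fun p v q h1 h2 h => by
      have := X.swap.disInv_of_between (p := p) (v := v) (q := q) h1 h2 (X.swap_disInv.2 h)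
      rwa [X.swap_disInv, X.swap_disInv] at this) hI.2 hx⟩

theorem isBlock_nonInv_component {I : Set V} (hI : X.IsBlock I) {x : V} (hx : x ∈ I) :
    X.IsBlock {y | JoinedWithin X.NonInv I x y} :=
  ⟨isIntervalFor_component (Q := X.NonInv) (fun _ _ h => h.symm) X.a_inj
      (fun _ _ _ h1 h2 h => X.nonInv_of_between h1 h2 h) hI.1 hx,
    isIntervalFor_component (Q := X.NonInv) (fun _ _ h => h.symm) X.b_inj (fun p v q h1 h2 h => by
      have := X.swap.nonInv_of_between (p := p) (v := v) (q := q) h1 h2 (X.swap_nonInv.2 h)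
      rwa [X.swap_nonInv, X.swap_nonInv] at this) hI.2 hx⟩

/-- Both pairs of orders agree on all proper subblocks of `I`. -/
def Reduced (I : Set V) : Prop :=
  ∀ J ⊆ I, J ≠ I → X.IsBlock J → ∀ x ∈ J, ∀ y ∈ J, ¬ X.Disagree x y

variable {X}

/-- The component of x is a block containing the disagreeing pair x, y, so by reducedness it cannot
be proper. -/
theorem Reduced.connectedOn_disInv {I : Set V} (hr : X.Reduced I) (hI : X.IsBlock I) {x y : V}
    (hx : x ∈ I) (hy : y ∈ I) (h : X.DisInv x y) : ConnectedOn X.DisInv I := by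
  have h1 : {z | JoinedWithin X.DisInv I x z} = I := by
    by_contra hne
    exact hr _ (fun z hz => JoinedWithin.mem hz hx) hne (X.isBlock_disInv_component hI hx)
      x .refl y (JoinedWithin.single hx hy h) h.2.2
  have h2 : ∀ z ∈ I, JoinedWithin X.DisInv I x z := fun z hz => by
    rw [← h1] at hz; exact hz
  exact fun p hp q hq => ((h2 p hp).symm fun _ _ h => h.symm).trans (h2 q hq)

/-- The three relations colour the pairs without rainbow triangles, so they cannot all be connected.
-/
theorem not_connectedOn_nonInv {I : Set V} (hfin : I.Finite)
    (hI : I.Nontrivial) (hD : ConnectedOn X.DisInv I) (hA : ConnectedOn X.AgreeInv I) :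
    ¬ ConnectedOn X.NonInv I := by
  classical
  intro hN
  let c : V → V → Fin 3 := fun x y => if X.NonInv x y then 0 else if X.DisInv x y then 1 else 2
  have hc : ∀ x y, c x y = c y x := by
    intro x y
    have e1 : X.NonInv x y ↔ X.NonInv y x := ⟨fun h => h.symm, fun h => h.symm⟩
    have e2 : X.DisInv x y ↔ X.DisInv y x := ⟨fun h => h.symm, fun h => h.symm⟩
    simp only [c, e1, e2]
  have hND : ∀ x y, X.NonInv x y → ¬ X.DisInv x y := fun x y h h' => h'.2.1 h.2
  have hNA : ∀ x y, X.NonInv x y → ¬ X.AgreeInv x y := fun x y h h' => h'.2.1 h.2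
  have hDA : ∀ x y, X.DisInv x y → ¬ X.AgreeInv x y := fun x y h h' => h.2.2 h'.2.2
  have c0 : ∀ x y, X.NonInv x y → c x y = 0 := fun x y h => by simp [c, h]
  have c1 : ∀ x y, X.DisInv x y → c x y = 1 := fun x y h => by
    simp only [c, if_neg fun h' => hND x y h' h, if_pos h]
  have c2 : ∀ x y, X.AgreeInv x y → c x y = 2 := fun x y h => by
    simp only [c, if_neg fun h' => hNA x y h' h, if_neg fun h' => hDA x y h' h]
  obtain ⟨k, hk⟩ := exists_not_connectedOn_of_no_rainbow c hc (by
    intro x y z hxy hyz hxz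
    by_contra! hcon
    have T := @not_nonInv_of_agreeInv_of_disInv V X
    rcases X.trichotomy hxy with h1 | h1 | h1 <;> rcases X.trichotomy hyz with h2 | h2 | h2 <;>
      rcases X.trichotomy hxz with h3 | h3 | h3 <;>
      first
      | exact T h1 h2 h3
      | exact T h2.symm h1.symm h3.symm
      | exact T h1.symm h3 h2
      | exact T h3.symm h1 h2.symm
      | exact T h2 h3.symm h1.symm
      | exact T h3 h2.symm h1
      | (simp [c0, c1, c2, h1, h2, h3] at hcon)) I.ncard I hfin rfl hI
  apply hk
  fin_cases k
  · exact hN.mono fun x _ y _ h => ⟨h.1, c0 x y h⟩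
  · exact hD.mono fun x _ y _ h => ⟨h.1, c1 x y h⟩
  · exact hA.mono fun x _ y _ h => ⟨h.1, c2 x y h⟩

/-- By `disInv_of_between`, a disagreeing inversion with an element in between can be replaced by a
shorter one. -/
theorem exists_adjacent_disInv {I : Set V} (hI : X.IsBlock I) {x y : V}
    (hx : x ∈ I) (hy : y ∈ I) (h : X.DisInv x y) :
    ∃ u ∈ I, ∃ v ∈ I, X.DisInv u v ∧ X.a u < X.a v ∧ ∀ w, X.a w ≤ X.a u ∨ X.a v ≤ X.a w := by
  have key : ∀ m : ℕ, ∀ u ∈ I, ∀ v ∈ I, X.DisInv u v → X.a u < X.a v → X.a v - X.a u = m →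
      ∃ u ∈ I, ∃ v ∈ I, X.DisInv u v ∧ X.a u < X.a v ∧ ∀ w, X.a w ≤ X.a u ∨ X.a v ≤ X.a w := by
    intro m
    induction m using Nat.strong_induction_on with
    | _ m ih =>
    intro u hu v hv huv hlt hm
    by_cases hc : ∀ w, X.a w ≤ X.a u ∨ X.a v ≤ X.a w
    · exact ⟨u, hu, v, hv, huv, hlt, hc⟩
    · push Not at hc
      obtain ⟨w, hw1, hw2⟩ := hc
      have hw := hI.1 u hu v hv w hw1 hw2
      rcases X.disInv_of_between hw1 hw2 huv with h | h
      · exact ih (X.a w - X.a u).toNat (by omega) u hu w hw h hw1 (by omega)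
      · exact ih (X.a v - X.a w).toNat (by omega) w hw v hv h hw2 (by omega)
  rcases lt_or_gt_of_ne (X.a_inj.ne h.1) with hlt | hlt
  · exact key _ x hx y hy h hlt (Int.toNat_of_nonneg (by omega)).symm
  · exact key _ y hy x hx h.symm hlt (Int.toNat_of_nonneg (by omega)).symm

theorem inv_of_not_joined {I : Set V} {x p q : V} (hx : x ∈ I)
    (hp : JoinedWithin X.NonInv I x p) (hq : q ∈ I) (hq' : ¬ JoinedWithin X.NonInv I x q) :
    p ≠ q ∧ ¬ X.NonInv p q :=
  ⟨by rintro rfl; exact hq' hp, fun h => hq' (hp.tail ⟨hp.mem hx, hq, h⟩)⟩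

/-- If the agreeing inversions were connected, the non-inversions would not be. The block then
splits into two non-inversion components L and R with only disagreeing inversions between them, so
no agreeing inversion could connect L with R. -/
theorem Reduced.not_connectedOn_agreeInv {I : Set V} (hfin : I.Finite) (hr : X.Reduced I)
    (hI : X.IsBlock I) {x y : V} (hx : x ∈ I) (hy : y ∈ I) (h : X.DisInv x y) :
    ¬ ConnectedOn X.AgreeInv I := by
  intro hA
  have hN : ¬ ConnectedOn X.NonInv I := not_connectedOn_nonInv hfin
    ⟨x, hx, y, hy, h.1⟩ (hr.connectedOn_disInv hI hx hy h) hA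
  obtain ⟨u, hu, v, hv, huv, hlt, hadj⟩ := exists_adjacent_disInv hI hx hy h
  have hsN : ∀ p q, X.NonInv p q → X.NonInv q p := fun _ _ h => h.symm
  set L := {z | JoinedWithin X.NonInv I u z} with hL
  set R := {z | JoinedWithin X.NonInv I v z} with hR
  have hLI : L ⊆ I := fun z hz => JoinedWithin.mem hz hu
  have hRI : R ⊆ I := fun z hz => JoinedWithin.mem hz hv
  have bL : X.IsBlock L := X.isBlock_nonInv_component hI hu
  have bR : X.IsBlock R := X.isBlock_nonInv_component hI hv
  have huL : u ∈ L := .refl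
  have hvR : v ∈ R := .refl
  -- L = I would make the non-inversions connected, and a proper block L cannot contain the
  -- disagreeing pair u, v.
  have hvL : v ∉ L := by
    intro hvL
    by_cases hLe : L = I
    · refine hN fun p hp q hq => ?_
      rw [← hLe] at hp hq
      exact (JoinedWithin.symm hsN hp).trans hq
    · exact hr L hLI hLe bL u huL v hvL huv.2.2
  have hdisj : ∀ z ∈ L, z ∉ R := fun z hz hz' =>
    hvL (JoinedWithin.trans hz (JoinedWithin.symm hsN hz'))
  have huR : u ∉ R := hdisj u huL
  have aL : ∀ l ∈ L, X.a l ≤ X.a u := by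
    intro l hl
    rcases hadj l with h | h
    · exact h
    · rcases h.eq_or_lt with h | h
      · exact absurd (X.a_inj h ▸ hl) hvL
      · exact absurd (bL.1 u huL l hl v hlt h) hvL
  have aR : ∀ r ∈ R, X.a v ≤ X.a r := by
    intro r hrR
    rcases hadj r with h | h
    · rcases h.eq_or_lt with h | h
      · exact absurd (X.a_inj h ▸ hrR) huR
      · exact absurd (bR.1 r hrR v hvR u h hlt) huR
    · exact h
  -- In the first order L ends at u and R starts at the next element v. In the second order an
  -- element of I between the two parts would form a non-inversion with a member of L or R.
  have bJ : X.IsBlock (L ∪ R) := by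
    constructor
    · rintro p hp q hq w hpw hwq
      rcases hp with hp | hp <;> rcases hq with hq | hq
      · exact Or.inl (bL.1 p hp q hq w hpw hwq)
      · rcases hadj w with h | h
        · rcases h.eq_or_lt with h | h
          · exact Or.inl (X.a_inj h ▸ huL)
          · exact Or.inl (bL.1 p hp u huL w hpw h)
        · rcases h.eq_or_lt with h | h
          · exact Or.inr (X.a_inj h ▸ hvR)
          · exact Or.inr (bR.1 v hvR q hq w h hwq)
      · have := aL q hq
        have := aR p hp
        omega
      · exact Or.inr (bR.1 p hp q hq w hpw hwq)
    · rintro p hp q hq w hpw hwq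
      by_contra hw
      have hwL : w ∉ L := fun h => hw (Or.inl h)
      have hwR : w ∉ R := fun h => hw (Or.inr h)
      have hpI : p ∈ I := hp.elim (fun h => hLI h) fun h => hRI h
      have hqI : q ∈ I := hq.elim (fun h => hLI h) fun h => hRI h
      have hwI : w ∈ I := hI.2 p hpI q hqI w hpw hwq
      rcases hp with hp | hp <;> rcases hq with hq | hq
      · exact hwL (bL.2 p hp q hq w hpw hwq)
      · obtain ⟨h1, h2⟩ := inv_of_not_joined hu hp (hRI hq) fun h => hdisj q h hq
        have := aL p hp
        have := aR q hq
        refine h2 ⟨h1, ?_⟩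
        constructor <;> intro <;> omega
      · rcases hadj w with h | h
        · obtain ⟨h1, h2⟩ := inv_of_not_joined hu hq hwI hwL
          have h3 : X.a w < X.a q := by
            by_contra h4
            have h5 := X.a_inj.ne h1
            have h6 : w ≠ u := by rintro rfl; exact hwL huL
            have h7 := X.a_inj.ne h6
            exact hwL (bL.1 q hq u huL w (by omega) (by omega))
          refine h2 ⟨h1, ?_⟩
          constructor <;> intro <;> omega
        · obtain ⟨h1, h2⟩ := inv_of_not_joined hv hp hwI hwR
          have h3 : X.a p < X.a w := by
            by_contra h4
            have h5 := X.a_inj.ne h1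
            have h6 : w ≠ v := by rintro rfl; exact hwR hvR
            have h7 := X.a_inj.ne h6
            exact hwR (bR.1 v hvR p hp w (by omega) (by omega))
          refine h2 ⟨h1, ?_⟩
          constructor <;> intro <;> omega
      · exact hwR (bR.2 p hp q hq w hpw hwq)
  have hJ : L ∪ R = I := by
    by_contra hne
    exact hr _ (Set.union_subset hLI hRI) hne bJ u (Or.inl huL) v (Or.inr hvR) huv.2.2
  -- Moving l along a non-inversion keeps a disagreeing inversion with r disagreeing, by the absence
  -- of rainbow triangles.
  have step : ∀ l ∈ L, ∀ r ∈ R, ∀ l' ∈ L, X.NonInv l l' → X.DisInv l r → X.DisInv l' r := by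
    intro l _ r hrR l' hl' hll hlr
    obtain ⟨h1, h2⟩ := inv_of_not_joined hu hl' (hRI hrR) fun h => hdisj r h hrR
    rcases X.trichotomy h1 with h3 | h3 | h3
    · exact absurd h3 h2
    · exact h3
    · exact absurd hll.symm (X.not_nonInv_of_agreeInv_of_disInv h3 hlr.symm)
  have step' : ∀ l ∈ L, ∀ r ∈ R, ∀ r' ∈ R, X.NonInv r r' → X.DisInv l r → X.DisInv l r' := by
    intro l hl r _ r' hr' hrr hlr
    obtain ⟨h1, h2⟩ := inv_of_not_joined hu hl (hRI hr') fun h => hdisj r' h hr'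
    rcases X.trichotomy h1 with h3 | h3 | h3
    · exact absurd h3 h2
    · exact h3
    · exact absurd hrr.symm (X.not_nonInv_of_agreeInv_of_disInv h3.symm hlr)
  have mono1 : ∀ l ∈ L, X.DisInv l v := by
    intro l hl
    have hl' : JoinedWithin X.NonInv I u l := hl
    clear hl
    induction hl' with
    | refl => exact huv
    | tail hp hpq ih => exact step _ hp v hvR _ (hp.tail hpq) hpq.2.2 ih
  have mono2 : ∀ l ∈ L, ∀ r ∈ R, X.DisInv l r := by
    intro l hl r hrR
    have hr' : JoinedWithin X.NonInv I v r := hrR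
    clear hrR
    induction hr' with
    | refl => exact mono1 l hl
    | tail hp hpq ih => exact step' l hl _ hp _ (hp.tail hpq) hpq.2.2 ih
  have hpath : ∀ z, JoinedWithin X.AgreeInv I u z → z ∈ L := by
    intro z hz
    induction hz with
    | refl => exact huL
    | @tail p q _ hpq ih =>
      have hq : q ∈ L ∪ R := hJ ▸ hpq.2.1
      rcases hq with hq | hq
      · exact hq
      · exact absurd hpq.2.2.2.2 (mono2 p ih q hq).2.2
  exact hvL (hpath v (hA u hu v hv))

end OrderPairs

/-! ### Spindle moves on arbitrary blocks of a pair of permutations. -/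

theorem SpindleEquivalent.trans {n : ℕ} {σ μ ν : Equiv.Perm (Fin n)}
    (h : SpindleEquivalent σ μ) (h' : SpindleEquivalent μ ν) : SpindleEquivalent σ ν :=
  Relation.EqvGen.trans _ _ _ h h'

theorem SpindleEquivalent.symm {n : ℕ} {σ μ : Equiv.Perm (Fin n)}
    (h : SpindleEquivalent σ μ) : SpindleEquivalent μ σ :=
  Relation.EqvGen.symm _ _ h

theorem SpindleEquivalent.refl {n : ℕ} (σ : Equiv.Perm (Fin n)) : SpindleEquivalent σ σ :=
  Relation.EqvGen.refl _

section

variable {n : ℕ}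

/-- Permutations `a`, `b` of a set of labels describe the spindle-permutation `b * a⁻¹`. -/
def PairEquivalent (a b a' b' : Equiv.Perm (Fin n)) : Prop :=
  SpindleEquivalent (b * a⁻¹) (b' * a'⁻¹)

theorem pairEquivalent_rotate [NeZero n] (a b : Equiv.Perm (Fin n)) (c d : Fin n) :
    PairEquivalent a b (Equiv.addRight c * a) (Equiv.addRight d * b) := by
  refine Relation.EqvGen.rel _ _ (Or.inl ⟨d, (-c : Fin n), d.2, (-c : Fin n).2, fun i j hij => ?_⟩)
  have h1 : j = i + -c := by
    ext
    rw [Fin.val_add]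
    rw [Nat.ModEq, Nat.mod_eq_of_lt j.2] at hij
    exact hij
  have h2 : (Equiv.addRight d * b * (Equiv.addRight c * a)⁻¹) i = (b * a⁻¹) j + d := by
    subst h1
    simp [Equiv.Perm.mul_apply, mul_inv_rev, Equiv.Perm.inv_def]
  rw [h2, Fin.val_add, add_comm (d : ℕ)]
  exact Nat.mod_modEq _ _

theorem pairEquivalent_block_swap {a b a' b' : Equiv.Perm (Fin n)} {k : ℕ} (hk : k ≤ n)
    (hS : ∀ i, (a i : ℕ) < k → (b i : ℕ) < k ∧ a' i = b i ∧ b' i = a i)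
    (hout : ∀ i, ¬ (a i : ℕ) < k → a' i = a i ∧ b' i = b i) : PairEquivalent a b a' b' := by
  refine Relation.EqvGen.rel _ _ (Or.inr (Or.inr ⟨k, hk, fun i hi => ?_, fun i hi => ?_,
    fun i hi => ?_⟩))
  · exact (hS (a⁻¹ i) (by simpa using hi)).1
  · have h0 : ∀ σ : Equiv.Perm (Fin n), (∀ j : Fin n, (j : ℕ) < k → (σ j : ℕ) < k) →
        ∀ j : Fin n, (j : ℕ) < k → (σ⁻¹ j : ℕ) < k := by
      intro σ hσ j hj
      by_contra hc
      have := not_lt_of_block hσ hc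
      simp [hj] at this
    have h1 := h0 (b * a⁻¹) (fun j hj => (hS (a⁻¹ j) (by simpa using hj)).1) i hi
    have h2 : (b * a⁻¹)⁻¹ i = a (b⁻¹ i) := by simp [mul_inv_rev]
    rw [h2] at h1 ⊢
    obtain ⟨-, h3, h4⟩ := hS _ h1
    have h5 : a'⁻¹ i = b⁻¹ i := by
      rw [Equiv.Perm.inv_eq_iff_eq, h3]; simp
    rw [Equiv.Perm.mul_apply, h5, h4]
  · obtain ⟨h3, h4⟩ := hout (a⁻¹ i) (by simpa using hi)
    have h5 : a'⁻¹ i = a⁻¹ i := by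
      rw [Equiv.Perm.inv_eq_iff_eq, h3]; simp
    rw [Equiv.Perm.mul_apply, h5, h4]
    rfl

theorem pairEquivalent_block_rotation {a b a' b' : Equiv.Perm (Fin n)} {k : ℕ} (hk : k ≤ n)
    (hS : ∀ i, (a i : ℕ) < k →
      (b i : ℕ) < k ∧ (a' i : ℕ) + a i + 1 = k ∧ (b' i : ℕ) + b i + 1 = k)
    (hout : ∀ i, ¬ (a i : ℕ) < k → a' i = a i ∧ b' i = b i) : PairEquivalent a b a' b' := by
  refine Relation.EqvGen.rel _ _ (Or.inr (Or.inl ⟨k, hk, fun i hi => ?_, fun i j hij => ?_,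
    fun i hi => ?_⟩))
  · exact (hS (a⁻¹ i) (by simpa using hi)).1
  · obtain ⟨-, h3, h4⟩ := hS (a⁻¹ j) (by
      have e : a (a⁻¹ j) = j := by simp
      rw [e]; omega)
    have h5 : a'⁻¹ i = a⁻¹ j := by
      rw [Equiv.Perm.inv_eq_iff_eq]
      have e : a (a⁻¹ j) = j := by simp
      rw [e] at h3
      ext
      omega
    rw [Equiv.Perm.mul_apply, h5]
    exact h4
  · obtain ⟨h3, h4⟩ := hout (a⁻¹ i) (by simpa using hi)
    have h5 : a'⁻¹ i = a⁻¹ i := by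
      rw [Equiv.Perm.inv_eq_iff_eq, h3]; simp
    rw [Equiv.Perm.mul_apply, h5, h4]
    rfl

theorem ncard_setOf_val_lt {k : ℕ} (hk : k ≤ n) (a : Equiv.Perm (Fin n)) :
    {i | (a i : ℕ) < k}.ncard = k := by
  have h1 : {i | (a i : ℕ) < k} = a ⁻¹' (Set.range (Fin.castLE hk)) := by
    ext i
    simp [Fin.range_castLE]
  rw [h1, Set.ncard_preimage_of_injective_subset_range a.injective (by simp),
    ← Set.image_univ, Set.ncard_image_of_injective _ (Fin.castLE_injective hk)]
  simp

theorem val_addRight_neg_mul [NeZero n] (p : Fin n) (a : Equiv.Perm (Fin n)) (i : Fin n) :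
    ((Equiv.addRight (-p) * a) i : ℕ) = if (p : ℕ) ≤ a i then (a i : ℕ) - p else n + a i - p := by
  have h0 : (Equiv.addRight (-p) * a) i = a i - p := (sub_eq_add_neg _ _).symm
  rw [h0]
  split_ifs with h
  · exact Fin.sub_val_of_le h
  · exact Fin.coe_sub_iff_lt.2 (not_le.1 h)

/-- An interval can be rotated to an initial segment. -/
theorem exists_rotation_to_initial [NeZero n] {a : Equiv.Perm (Fin n)} {I : Set (Fin n)}
    (hI : IsIntervalFor I a) (hne : I.Nonempty) :
    ∃ p : Fin n, p + I.ncard ≤ n ∧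
      (∀ i, i ∈ I ↔ ((Equiv.addRight (-p) * a) i : ℕ) < I.ncard) ∧
      ∀ i ∈ I, (a i : ℕ) = p + ((Equiv.addRight (-p) * a) i : ℕ) := by
  obtain ⟨u, hu, hmin⟩ := Set.exists_min_image I a (Set.toFinite I) hne
  obtain ⟨w, hw, hmax⟩ := Set.exists_max_image I a (Set.toFinite I) hne
  have hval := fun i => val_addRight_neg_mul (a u) a i
  have hmem : ∀ i, i ∈ I ↔ a u ≤ a i ∧ a i ≤ a w := by
    intro i
    refine ⟨fun hi => ⟨hmin i hi, hmax i hi⟩, fun ⟨h1, h2⟩ => ?_⟩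
    rcases h1.eq_or_lt with h1 | h1
    · exact a.injective h1 ▸ hu
    · rcases h2.eq_or_lt with h2 | h2
      · exact a.injective h2 ▸ hw
      · exact hI u hu w hw i h1 h2
  have huw : (a u : ℕ) ≤ a w := hmin w hw
  have hlt : ∀ i, i ∈ I ↔ ((Equiv.addRight (-(a u)) * a) i : ℕ) < (a w : ℕ) - a u + 1 := by
    intro i
    rw [hmem, hval, Fin.le_def, Fin.le_def]
    have := (a w).2
    have := (a i).2
    split_ifs <;> omega
  have hcard : I.ncard = (a w : ℕ) - a u + 1 := by
    have h1 : I = {i | ((Equiv.addRight (-(a u)) * a) i : ℕ) < (a w : ℕ) - a u + 1} :=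
      Set.ext hlt
    conv_lhs => rw [h1]
    exact ncard_setOf_val_lt (by have := (a w).2; omega) _
  refine ⟨a u, ?_, ?_, ?_⟩
  · have := (a w).2
    omega
  · rw [hcard]
    exact hlt
  · intro i hi
    have : (a u : ℕ) ≤ a i := hmin i hi
    rw [hval, if_pos this]
    omega

/-- `(a', b')` arises from `(a, b)` by moves within the block `I`. -/
structure ReachableWithin (I : Set (Fin n)) (a b a' b' : Equiv.Perm (Fin n)) : Prop where
  equivalent : PairEquivalent a b a' b'
  eq_fst : ∀ i ∉ I, a' i = a i
  eq_snd : ∀ i ∉ I, b' i = b i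

theorem ReachableWithin.refl (I : Set (Fin n)) (a b : Equiv.Perm (Fin n)) :
    ReachableWithin I a b a b :=
  ⟨SpindleEquivalent.refl _, fun _ _ => rfl, fun _ _ => rfl⟩

theorem ReachableWithin.trans {I : Set (Fin n)} {a b a' b' a'' b'' : Equiv.Perm (Fin n)}
    (h : ReachableWithin I a b a' b') (h' : ReachableWithin I a' b' a'' b'') :
    ReachableWithin I a b a'' b'' :=
  ⟨SpindleEquivalent.trans h.equivalent h'.equivalent,
    fun i hi => (h'.eq_fst i hi).trans (h.eq_fst i hi),
    fun i hi => (h'.eq_snd i hi).trans (h.eq_snd i hi)⟩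

theorem ReachableWithin.mono {I J : Set (Fin n)} {a b a' b' : Equiv.Perm (Fin n)} (hIJ : I ⊆ J)
    (h : ReachableWithin I a b a' b') : ReachableWithin J a b a' b' :=
  ⟨h.equivalent, fun i hi => h.eq_fst i fun h => hi (hIJ h),
    fun i hi => h.eq_snd i fun h => hi (hIJ h)⟩

/-- Performing moves on a block after rotating it to an initial segment. -/
theorem exists_reachable_of_initial [NeZero n] {a b : Equiv.Perm (Fin n)} {I : Set (Fin n)}
    (ha : IsIntervalFor I a) (hb : IsIntervalFor I b) (hne : I.Nonempty) :
    ∃ a₁ b₁ : Equiv.Perm (Fin n), (∀ i, i ∈ I ↔ (a₁ i : ℕ) < I.ncard) ∧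
      (∀ i, i ∈ I ↔ (b₁ i : ℕ) < I.ncard) ∧
      (∀ i ∈ I, ∀ j ∈ I, (a₁ i < a₁ j ↔ a i < a j) ∧ (b₁ i < b₁ j ↔ b i < b j)) ∧
      ∀ a₂ b₂ : Equiv.Perm (Fin n), PairEquivalent a₁ b₁ a₂ b₂ →
        (∀ i ∈ I, (a₂ i : ℕ) < I.ncard ∧ (b₂ i : ℕ) < I.ncard) →
        (∀ i ∉ I, a₂ i = a₁ i ∧ b₂ i = b₁ i) →
        ∃ a' b' : Equiv.Perm (Fin n), ReachableWithin I a b a' b' ∧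
          ∀ i ∈ I, ∀ j ∈ I, (a' i < a' j ↔ a₂ i < a₂ j) ∧ (b' i < b' j ↔ b₂ i < b₂ j) := by
  obtain ⟨p, hp1, hp2, hp3⟩ := exists_rotation_to_initial ha hne
  obtain ⟨q, hq1, hq2, hq3⟩ := exists_rotation_to_initial hb hne
  refine ⟨Equiv.addRight (-p) * a, Equiv.addRight (-q) * b, hp2, hq2, fun i hi j hj => ?_,
    fun a₂ b₂ hE hin hout => ?_⟩
  · have h1 := hp3 i hi
    have h2 := hp3 j hj
    have h3 := hq3 i hi
    have h4 := hq3 j hj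
    simp only [Fin.lt_def]
    omega
  · refine ⟨Equiv.addRight p * a₂, Equiv.addRight q * b₂, ⟨?_, fun i hi => ?_, fun i hi => ?_⟩,
      fun i hi j hj => ?_⟩
    · exact ((pairEquivalent_rotate a b (-p) (-q)).trans hE).trans
        (pairEquivalent_rotate a₂ b₂ p q)
    · simp [(hout i hi).1]
    · simp [(hout i hi).2]
    -- Rotating back does not wrap around on I, because p + |I| ≤ n and q + |I| ≤ n. Orders within I
    -- are therefore preserved.
    · have key : ∀ (r : Fin n) (c : Equiv.Perm (Fin n)) (i : Fin n), (r : ℕ) + I.ncard ≤ n →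
          (c i : ℕ) < I.ncard → ((Equiv.addRight r * c) i : ℕ) = c i + r := by
        intro r c i h1 h2
        rw [Equiv.Perm.mul_apply, Equiv.coe_addRight, Fin.val_add, Nat.mod_eq_of_lt (by omega)]
      have h1 := key p a₂ i hp1 (hin i hi).1
      have h2 := key p a₂ j hp1 (hin j hj).1
      have h3 := key q b₂ i hq1 (hin i hi).2
      have h4 := key q b₂ j hq1 (hin j hj).2
      simp only [Fin.lt_def]
      omega

theorem exists_piecewise_perm {I : Set (Fin n)} {a b : Equiv.Perm (Fin n)} {k : ℕ}
    (ha : ∀ i, i ∈ I ↔ (a i : ℕ) < k) (hb : ∀ i, i ∈ I ↔ (b i : ℕ) < k) :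
    ∃ c : Equiv.Perm (Fin n), (∀ i ∈ I, c i = b i) ∧ ∀ i ∉ I, c i = a i := by
  classical
  have hinj : Function.Injective fun i => if i ∈ I then b i else a i := by
    intro i j hij
    by_cases hi : i ∈ I <;> by_cases hj : j ∈ I <;> simp only [hi, hj, if_true, if_false] at hij
    · exact b.injective hij
    · exact absurd ((ha j).2 (hij ▸ (hb i).1 hi)) hj
    · exact absurd ((ha i).2 (hij ▸ (hb j).1 hj)) hi
    · exact a.injective hij
  refine ⟨Equiv.ofBijective _ (Finite.injective_iff_bijective.1 hinj), fun i hi => ?_,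
    fun i hi => ?_⟩
  · simp [Equiv.ofBijective_apply, hi]
  · simp [Equiv.ofBijective_apply, hi]

theorem exists_reachable_swap [NeZero n] {a b : Equiv.Perm (Fin n)} {I : Set (Fin n)}
    (ha : IsIntervalFor I a) (hb : IsIntervalFor I b) (hne : I.Nonempty) :
    ∃ a' b' : Equiv.Perm (Fin n), ReachableWithin I a b a' b' ∧
      ∀ i ∈ I, ∀ j ∈ I, (a' i < a' j ↔ b i < b j) ∧ (b' i < b' j ↔ a i < a j) := by
  obtain ⟨a₁, b₁, h1, h2, h3, h4⟩ := exists_reachable_of_initial ha hb hne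
  obtain ⟨a₂, ha₂, ha₂'⟩ := exists_piecewise_perm h1 h2
  obtain ⟨b₂, hb₂, hb₂'⟩ := exists_piecewise_perm h2 h1
  have hk : I.ncard ≤ n := by
    simpa using Set.ncard_le_card I
  obtain ⟨a', b', h5, h6⟩ := h4 a₂ b₂
    (pairEquivalent_block_swap hk
      (fun i hi => ⟨(h2 i).1 ((h1 i).2 hi), ha₂ i ((h1 i).2 hi), hb₂ i ((h1 i).2 hi)⟩)
      (fun i hi => ⟨ha₂' i fun h => hi ((h1 i).1 h), hb₂' i fun h => hi ((h1 i).1 h)⟩))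
    (fun i hi => ⟨ha₂ i hi ▸ (h2 i).1 hi, hb₂ i hi ▸ (h1 i).1 hi⟩)
    (fun i hi => ⟨ha₂' i hi, hb₂' i hi⟩)
  refine ⟨a', b', h5, fun i hi j hj => ?_⟩
  have := h3 i hi j hj
  have := h6 i hi j hj
  rw [ha₂ i hi, ha₂ j hj, hb₂ i hi, hb₂ j hj] at this
  tauto

theorem exists_reachable_rotation [NeZero n] {a b : Equiv.Perm (Fin n)} {I : Set (Fin n)}
    (ha : IsIntervalFor I a) (hb : IsIntervalFor I b) (hne : I.Nonempty) :
    ∃ a' b' : Equiv.Perm (Fin n), ReachableWithin I a b a' b' ∧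
      ∀ i ∈ I, ∀ j ∈ I, (a' i < a' j ↔ a j < a i) ∧ (b' i < b' j ↔ b j < b i) := by
  obtain ⟨a₁, b₁, h1, h2, h3, h4⟩ := exists_reachable_of_initial ha hb hne
  have hk : I.ncard ≤ n := by
    simpa using Set.ncard_le_card I
  have r1 : ∀ (c : Equiv.Perm (Fin n)) i, (c i : ℕ) < I.ncard →
      ((blockReverse I.ncard hk * c) i : ℕ) + c i + 1 = I.ncard := fun c i hi =>
    blockReverse_add hk hi
  have r2 : ∀ (c : Equiv.Perm (Fin n)) i, ¬ (c i : ℕ) < I.ncard →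
      (blockReverse I.ncard hk * c) i = c i := fun c i hi => blockReverse_of_not_lt hk hi
  obtain ⟨a', b', h5, h6⟩ := h4 (blockReverse I.ncard hk * a₁) (blockReverse I.ncard hk * b₁)
    (pairEquivalent_block_rotation hk
      (fun i hi => ⟨(h2 i).1 ((h1 i).2 hi), r1 a₁ i hi, r1 b₁ i ((h2 i).1 ((h1 i).2 hi))⟩)
      (fun i hi => ⟨r2 a₁ i hi, r2 b₁ i fun h => hi ((h1 i).1 ((h2 i).2 h))⟩))
    (fun i hi => ⟨by have := r1 a₁ i ((h1 i).1 hi); omega,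
      by have := r1 b₁ i ((h2 i).1 hi); omega⟩)
    (fun i hi => ⟨r2 a₁ i fun h => hi ((h1 i).2 h), r2 b₁ i fun h => hi ((h2 i).2 h)⟩)
  refine ⟨a', b', h5, fun i hi j hj => ?_⟩
  have e1 := h3 j hj i hi
  have e2 := h6 i hi j hj
  have f1 := r1 a₁ i ((h1 i).1 hi)
  have f2 := r1 a₁ j ((h1 j).1 hj)
  have f3 := r1 b₁ i ((h2 i).1 hi)
  have f4 := r1 b₁ j ((h2 j).1 hj)
  rw [e2.1, e2.2, ← e1.1, ← e1.2]
  simp only [Fin.lt_def]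
  omega

/-- Moves within an interval do not change the relative order of two labels that are not both
in the interval. -/
theorem lt_iff_of_eq_outside {I : Set (Fin n)} {a a' : Equiv.Perm (Fin n)}
    (hI : IsIntervalFor I a) (h : ∀ i ∉ I, a' i = a i) {i j : Fin n} (hij : i ∉ I ∨ j ∉ I) :
    a' i < a' j ↔ a i < a j := by
  -- Permutations that agree outside I have the same image of I. That image is an interval, so an
  -- outside label is on the same side of all of it.
  have key : ∀ x ∈ I, ∃ y ∈ I, a' x = a y := by
    intro x hx
    refine ⟨a⁻¹ (a' x), ?_, by simp⟩
    by_contra hc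
    have h1 := h _ hc
    have h2 : a⁻¹ (a' x) = x := a'.injective (by rw [h1]; simp)
    rw [h2] at hc
    exact hc hx
  have hlt : ∀ x ∈ I, ∀ y ∈ I, ∀ v ∉ I, a v < a x → a v < a y := by
    intro x hx y hy v hv hvx
    by_contra hc
    have : a y < a v := lt_of_le_of_ne (not_lt.1 hc) (a.injective.ne fun e => hv (e ▸ hy))
    exact hv (hI y hy x hx v this hvx)
  have hgt : ∀ x ∈ I, ∀ y ∈ I, ∀ v ∉ I, a x < a v → a y < a v := by
    intro x hx y hy v hv hvx
    by_contra hc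
    have : a v < a y := lt_of_le_of_ne (not_lt.1 hc) (a.injective.ne fun e => hv (e ▸ hy))
    exact hv (hI x hx y hy v hvx this)
  by_cases hi : i ∈ I
  · have hj : j ∉ I := hij.resolve_left fun h => h hi
    obtain ⟨y, hy, e⟩ := key i hi
    rw [e, h j hj]
    exact ⟨fun h => hgt y hy i hi j hj h, fun h => hgt i hi y hy j hj h⟩
  · by_cases hj : j ∈ I
    · obtain ⟨y, hy, e⟩ := key j hj
      rw [e, h i hi]
      exact ⟨fun h => hlt y hy j hj i hi h, fun h => hlt j hj y hy i hi h⟩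
    · rw [h i hi, h j hj]

theorem IsIntervalFor.of_eq_outside {I J : Set (Fin n)} {a a' : Equiv.Perm (Fin n)}
    (hI : IsIntervalFor I a) (hJ : IsIntervalFor J a) (hIJ : I ⊆ J) (h : ∀ i ∉ I, a' i = a i) :
    IsIntervalFor J a' := by
  intro u hu w hw v huv hvw
  by_contra hv
  have hvI : v ∉ I := fun h => hv (hIJ h)
  rw [lt_iff_of_eq_outside hI h (Or.inr hvI)] at huv
  rw [lt_iff_of_eq_outside hI h (Or.inl hvI)] at hvw
  exact hv (hJ u hu w hw v huv hvw)

end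

/-! ### Matching pairs of permutations with equal inversion graphs. -/

theorem iff_of_not_iff_of_not_iff {p q r : Prop} (h : ¬ (p ↔ q)) (h' : ¬ (q ↔ r)) : p ↔ r := by
  tauto

theorem OrderPairs.Reduced.mirror {V : Type*} {X : OrderPairs V} {I : Set V} (h : X.Reduced I) :
    X.mirror.Reduced I := fun J hJ hne hb =>
  h J hJ hne ⟨hb.1, fun u hu w hw v huv hvw =>
    hb.2 w hw u hu v (neg_lt_neg hvw) (neg_lt_neg huv)⟩

theorem OrderPairs.IsBlock.mirror {V : Type*} {X : OrderPairs V} {I : Set V} (h : X.IsBlock I) :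
    X.mirror.IsBlock I :=
  ⟨h.1, fun u hu w hw v huv hvw =>
    h.2 w hw u hu v (neg_lt_neg_iff.1 hvw) (neg_lt_neg_iff.1 huv)⟩

section

variable {n : ℕ} {a b c d a' b' a'' b'' : Equiv.Perm (Fin n)} {I J : Set (Fin n)}

/-- The permutations `b * a⁻¹` and `d * c⁻¹` have the same graph of inversions, with respect to
the labels. -/
def SameInversions (a b c d : Equiv.Perm (Fin n)) : Prop :=
  ∀ i j, i ≠ j → ((a i < a j ↔ b i < b j) ↔ (c i < c j ↔ d i < d j))

theorem SameInversions.symm (h : SameInversions a b c d) : SameInversions c d a b :=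
  fun i j hij => (h i j hij).symm

theorem SameInversions.trans (h : SameInversions a b a' b') (h' : SameInversions a' b' c d) :
    SameInversions a b c d := fun i j hij => (h i j hij).trans (h' i j hij)

theorem injective_cast_perm (a : Equiv.Perm (Fin n)) :
    Function.Injective fun i => ((a i : ℕ) : ℤ) :=
  Nat.cast_injective.comp (Fin.val_injective.comp a.injective)

/-- The pairs of orders given by two pairs of permutations with the same inversions. -/
def SameInversions.toOrderPairs (h : SameInversions a b c d) : OrderPairs (Fin n) where
  a i := (a i : ℕ)
  b i := (b i : ℕ)
  a' i := (c i : ℕ)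
  b' i := (d i : ℕ)
  a_inj := injective_cast_perm a
  b_inj := injective_cast_perm b
  a'_inj := injective_cast_perm c
  b'_inj := injective_cast_perm d
  same i j hij := by simpa using h i j hij

theorem isIntervalFor_cast : IsIntervalFor I (fun i => ((a i : ℕ) : ℤ)) ↔ IsIntervalFor I a := by
  simp [IsIntervalFor]

theorem SameInversions.isBlock (h : SameInversions a b c d) :
    h.toOrderPairs.IsBlock I ↔ IsIntervalFor I a ∧ IsIntervalFor I b :=
  and_congr isIntervalFor_cast isIntervalFor_cast

theorem SameInversions.disInv (h : SameInversions a b c d) {i j : Fin n} :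
    h.toOrderPairs.DisInv i j ↔
      i ≠ j ∧ ¬ (a i < a j ↔ b i < b j) ∧ ¬ (a i < a j ↔ c i < c j) := by
  simp [OrderPairs.DisInv, SameInversions.toOrderPairs]

theorem SameInversions.agreeInv (h : SameInversions a b c d) {i j : Fin n} :
    h.toOrderPairs.AgreeInv i j ↔
      i ≠ j ∧ ¬ (a i < a j ↔ b i < b j) ∧ (a i < a j ↔ c i < c j) := by
  simp [OrderPairs.AgreeInv, SameInversions.toOrderPairs]

theorem not_lt_iff_perm (a : Equiv.Perm (Fin n)) {i j : Fin n} (h : i ≠ j) :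
    a j < a i ↔ ¬ a i < a j := by
  rw [not_lt, le_iff_lt_or_eq, or_iff_left (a.injective.ne h.symm)]

theorem SameInversions.mirror_disInv (h : SameInversions a b c d) {i j : Fin n} :
    h.toOrderPairs.mirror.DisInv i j ↔
      i ≠ j ∧ (a i < a j ↔ b i < b j) ∧ ¬ (a i < a j ↔ c i < c j) := by
  by_cases hij : i = j
  · simp [OrderPairs.DisInv, hij]
  · have := not_lt_iff_perm b hij
    simp [OrderPairs.DisInv, SameInversions.toOrderPairs, OrderPairs.mirror, hij]
    tauto

theorem SameInversions.mirror_agreeInv (h : SameInversions a b c d) {i j : Fin n} :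
    h.toOrderPairs.mirror.AgreeInv i j ↔
      i ≠ j ∧ (a i < a j ↔ b i < b j) ∧ (a i < a j ↔ c i < c j) := by
  by_cases hij : i = j
  · simp [OrderPairs.AgreeInv, hij]
  · have := not_lt_iff_perm b hij
    simp [OrderPairs.AgreeInv, SameInversions.toOrderPairs, OrderPairs.mirror, hij]
    tauto

/-- `(a', b')` arises from `(a, b)` by moves within the block `I` that preserve inversions. -/
structure MovesWithin (I : Set (Fin n)) (a b a' b' : Equiv.Perm (Fin n)) : Prop extends
    ReachableWithin I a b a' b' where
  interval_fst : IsIntervalFor I a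
  interval_snd : IsIntervalFor I b
  same : SameInversions a b a' b'

theorem MovesWithin.refl (ha : IsIntervalFor I a) (hb : IsIntervalFor I b) :
    MovesWithin I a b a b :=
  ⟨ReachableWithin.refl I a b, ha, hb, fun _ _ _ => Iff.rfl⟩

theorem MovesWithin.trans (h : MovesWithin I a b a' b') (h' : MovesWithin I a' b' a'' b'') :
    MovesWithin I a b a'' b'' :=
  ⟨h.toReachableWithin.trans h'.toReachableWithin, h.interval_fst, h.interval_snd,
    h.same.trans h'.same⟩

theorem MovesWithin.interval_fst' (h : MovesWithin I a b a' b') : IsIntervalFor I a' :=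
  h.interval_fst.of_eq_outside h.interval_fst subset_rfl h.eq_fst

theorem MovesWithin.interval_snd' (h : MovesWithin I a b a' b') : IsIntervalFor I b' :=
  h.interval_snd.of_eq_outside h.interval_snd subset_rfl h.eq_snd

theorem MovesWithin.mono (h : MovesWithin J a b a' b') (hJ : J ⊆ I) (ha : IsIntervalFor I a)
    (hb : IsIntervalFor I b) : MovesWithin I a b a' b' :=
  ⟨h.toReachableWithin.mono hJ, ha, hb, h.same⟩

theorem ReachableWithin.movesWithin (h : ReachableWithin I a b a' b') (ha : IsIntervalFor I a)
    (hb : IsIntervalFor I b)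
    (hs : ∀ i ∈ I, ∀ j ∈ I, i ≠ j → ((a i < a j ↔ b i < b j) ↔ (a' i < a' j ↔ b' i < b' j))) :
    MovesWithin I a b a' b' := by
  refine ⟨h, ha, hb, fun i j hij => ?_⟩
  by_cases hi : i ∈ I
  · by_cases hj : j ∈ I
    · exact hs i hi j hj hij
    · rw [lt_iff_of_eq_outside ha h.eq_fst (Or.inr hj), lt_iff_of_eq_outside hb h.eq_snd (Or.inr hj)]
  · rw [lt_iff_of_eq_outside ha h.eq_fst (Or.inl hi), lt_iff_of_eq_outside hb h.eq_snd (Or.inl hi)]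

/-- Exchanging the two orders on a block reverses the first order on inversions and keeps it on
non-inversions. -/
theorem exists_movesWithin_swap [NeZero n] (ha : IsIntervalFor I a) (hb : IsIntervalFor I b)
    (hne : I.Nonempty) : ∃ a' b', MovesWithin I a b a' b' ∧
      ∀ i ∈ I, ∀ j ∈ I, (a' i < a' j ↔ b i < b j) := by
  obtain ⟨a', b', h, h'⟩ := exists_reachable_swap ha hb hne
  refine ⟨a', b', h.movesWithin ha hb fun i hi j hj _ => ?_, fun i hi j hj => (h' i hi j hj).1⟩
  rw [(h' i hi j hj).1, (h' i hi j hj).2]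
  tauto

/-- The complementary effect: the first order is kept on inversions and reversed on non-inversions
of the block. -/
theorem exists_movesWithin_swap_rotation [NeZero n] (ha : IsIntervalFor I a)
    (hb : IsIntervalFor I b) (hne : I.Nonempty) : ∃ a' b', MovesWithin I a b a' b' ∧
      ∀ i ∈ I, ∀ j ∈ I, (a' i < a' j ↔ b j < b i) := by
  obtain ⟨a₁, b₁, h, h'⟩ := exists_movesWithin_swap ha hb hne
  obtain ⟨a₂, b₂, h₁, h₁'⟩ := exists_reachable_rotation h.interval_fst' h.interval_snd' hne
  refine ⟨a₂, b₂, h.trans (h₁.movesWithin h.interval_fst' h.interval_snd' fun i hi j hj hij => ?_),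
    fun i hi j hj => (h₁' i hi j hj).1.trans (h' j hj i hi)⟩
  rw [(h₁' i hi j hj).1, (h₁' i hi j hj).2, not_lt_iff_perm a₁ hij, not_lt_iff_perm b₁ hij]
  tauto

/-- The orders given by `a` and `c` agree on all proper common subintervals of `I`. -/
def ReducedWithin (I : Set (Fin n)) (a b c : Equiv.Perm (Fin n)) : Prop :=
  ∀ J ⊆ I, J ≠ I → IsIntervalFor J a → IsIntervalFor J b →
    ∀ x ∈ J, ∀ y ∈ J, (a x < a y ↔ c x < c y)

theorem ReducedWithin.toOrderPairs (h : ReducedWithin I a b c) (hs : SameInversions a b c d) :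
    hs.toOrderPairs.Reduced I := by
  intro J hJ hne hb x hx y hy hxy
  have hb := hs.isBlock.1 hb
  apply hxy
  simpa [SameInversions.toOrderPairs] using h J hJ hne hb.1 hb.2 x hx y hy

/-- Every pair of permutations with the inversions of `(c, d)` can be moved within the block `I`
such that its orders agree with those of `(c, d)` on `I`. -/
def CanMatch (c d : Equiv.Perm (Fin n)) (I : Set (Fin n)) : Prop :=
  ∀ a b : Equiv.Perm (Fin n), IsIntervalFor I a → IsIntervalFor I b → SameInversions a b c d →
    ∃ a' b', MovesWithin I a b a' b' ∧ ∀ x ∈ I, ∀ y ∈ I, (a' x < a' y ↔ c x < c y)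

/-- Matching a proper subblock removes its disagreements and creates none elsewhere, so their number
drops. The last clause records that no new disagreement appears. -/
theorem exists_movesWithin_reducedWithin (ih : ∀ J, J ⊂ I → CanMatch c d J) (m : ℕ) :
    ∀ a b : Equiv.Perm (Fin n), IsIntervalFor I a → IsIntervalFor I b → SameInversions a b c d →
      {p : Fin n × Fin n | p.1 ∈ I ∧ p.2 ∈ I ∧ ¬ (a p.1 < a p.2 ↔ c p.1 < c p.2)}.ncard = m →
      ∃ a' b', MovesWithin I a b a' b' ∧ ReducedWithin I a' b' c ∧
        ∀ x ∈ I, ∀ y ∈ I, ¬ (a' x < a' y ↔ c x < c y) → ¬ (a x < a y ↔ c x < c y) := by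
  induction m using Nat.strong_induction_on with
  | _ m ihm =>
  intro a b ha hb hs hm
  by_cases hred : ReducedWithin I a b c
  · exact ⟨a, b, MovesWithin.refl ha hb, hred, fun _ _ _ _ h => h⟩
  · unfold ReducedWithin at hred
    simp only [not_forall] at hred
    obtain ⟨J, hJI, hne, hJa, hJb, x, hx, y, hy, hxy⟩ := hred
    obtain ⟨a₁, b₁, h₁, h₁'⟩ := ih J (hJI.ssubset_of_ne hne) a b hJa hJb hs
    have hI₁ := h₁.mono hJI ha hb
    have hdis : ∀ u v, ¬ (a₁ u < a₁ v ↔ c u < c v) → ¬ (a u < a v ↔ c u < c v) := by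
      intro u v huv
      by_cases hu : u ∈ J
      · by_cases hv : v ∈ J
        · exact absurd (h₁' u hu v hv) huv
        · rwa [← lt_iff_of_eq_outside hJa h₁.eq_fst (Or.inr hv)]
      · rwa [← lt_iff_of_eq_outside hJa h₁.eq_fst (Or.inl hu)]
    obtain ⟨a₂, b₂, h₂, hr₂, hd₂⟩ := ihm _ (by
        rw [← hm]
        refine Set.ncard_lt_ncard ⟨fun p hp => ⟨hp.1, hp.2.1, hdis _ _ hp.2.2⟩, fun hsub => ?_⟩
          (Set.toFinite _)
        have : (x, y) ∈ {p : Fin n × Fin n | p.1 ∈ I ∧ p.2 ∈ I ∧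
          ¬ (a p.1 < a p.2 ↔ c p.1 < c p.2)} := ⟨hJI hx, hJI hy, hxy⟩
        exact (hsub this).2.2 (h₁' x hx y hy)) a₁ b₁ hI₁.interval_fst' hI₁.interval_snd'
      (hI₁.same.symm.trans hs) rfl
    exact ⟨a₂, b₂, hI₁.trans h₂, hr₂, fun u hu v hv h => hdis u v (hd₂ u hu v hv h)⟩

theorem exists_movesWithin_no_disInv [NeZero n] (ih : ∀ J, J ⊂ I → CanMatch c d J)
    (ha : IsIntervalFor I a) (hb : IsIntervalFor I b) (hs : SameInversions a b c d) :
    ∃ a' b', MovesWithin I a b a' b' ∧ ReducedWithin I a' b' c ∧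
      ∀ x ∈ I, ∀ y ∈ I, ¬ (a' x < a' y ↔ b' x < b' y) → (a' x < a' y ↔ c x < c y) := by
  obtain ⟨a₁, b₁, h₁, hr₁, -⟩ := exists_movesWithin_reducedWithin ih _ a b ha hb hs rfl
  by_cases hx : ∀ x ∈ I, ∀ y ∈ I, ¬ (a₁ x < a₁ y ↔ b₁ x < b₁ y) → (a₁ x < a₁ y ↔ c x < c y)
  · exact ⟨a₁, b₁, h₁, hr₁, hx⟩
  · simp only [not_forall] at hx
    obtain ⟨x, hx, y, hy, hxy, hxy'⟩ := hx
    have hne : x ≠ y := by rintro rfl; simp at hxy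
    have hs₁ := h₁.same.symm.trans hs
    have hA := (hr₁.toOrderPairs hs₁).not_connectedOn_agreeInv (Set.toFinite I)
      (hs₁.isBlock.2 ⟨h₁.interval_fst', h₁.interval_snd'⟩) hx hy
      (hs₁.disInv.2 ⟨hne, hxy, hxy'⟩)
    -- The swap interchanges agreeing and disagreeing inversions. Any disagreeing inversion
    -- surviving the renewed reduction was therefore an agreeing one before.
    obtain ⟨a₂, b₂, h₂, h₂'⟩ := exists_movesWithin_swap h₁.interval_fst' h₁.interval_snd' ⟨x, hx⟩
    obtain ⟨a₃, b₃, h₃, hr₃, hd₃⟩ := exists_movesWithin_reducedWithin ih _ a₂ b₂ h₂.interval_fst'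
      h₂.interval_snd' (h₂.same.symm.trans hs₁) rfl
    refine ⟨a₃, b₃, h₁.trans (h₂.trans h₃), hr₃, fun u hu v hv huv => ?_⟩
    by_contra hc
    have hs₃ := (h₂.trans h₃).same.symm.trans hs₁
    have hne' : u ≠ v := by rintro rfl; simp at huv
    -- Surviving disagreeing inversions are connected on the reduced block, and they lie in the
    -- agreeing graph that `hA` says is disconnected.
    refine hA (((hr₃.toOrderPairs hs₃).connectedOn_disInv
      (hs₃.isBlock.2 ⟨h₃.interval_fst', h₃.interval_snd'⟩) hu hv
      (hs₃.disInv.2 ⟨hne', huv, hc⟩)).mono fun p hp q hq hpq => ?_)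
    obtain ⟨e1, e2, e3⟩ := hs₃.disInv.1 hpq
    have e4 := hd₃ p hp q hq e3
    rw [h₂' p hp q hq] at e4
    have e5 := (h₂.trans h₃).same p q e1
    have e6 := fun h => e2 (e5.1 h)
    exact hs₁.agreeInv.2 ⟨e1, e6, iff_of_not_iff_of_not_iff e6 e4⟩

/-- Inversions are matched first; non-inversions are then treated as the inversions of the mirrored
pairs. -/
theorem canMatch [NeZero n] (c d : Equiv.Perm (Fin n)) (m : ℕ) :
    ∀ I : Set (Fin n), I.ncard = m → CanMatch c d I := by
  induction m using Nat.strong_induction_on with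
  | _ m ihm =>
  intro I hm a b ha hb hs
  have ih : ∀ J, J ⊂ I → CanMatch c d J := fun J hJ =>
    ihm _ (hm ▸ Set.ncard_lt_ncard hJ (Set.toFinite I)) J rfl
  obtain ⟨a₁, b₁, h₁, hr₁, hd₁⟩ := exists_movesWithin_no_disInv ih ha hb hs
  by_cases hx : ∀ x ∈ I, ∀ y ∈ I, (a₁ x < a₁ y ↔ c x < c y)
  · exact ⟨a₁, b₁, h₁, hx⟩
  · simp only [not_forall] at hx
    obtain ⟨x, hx, y, hy, hxy⟩ := hx
    have hne : x ≠ y := by rintro rfl; simp at hxy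
    have hs₁ := h₁.same.symm.trans hs
    have hxy' := not_imp_comm.1 (hd₁ x hx y hy) hxy
    have hA := (hr₁.toOrderPairs hs₁).mirror.not_connectedOn_agreeInv (Set.toFinite I)
      (hs₁.isBlock.2 ⟨h₁.interval_fst', h₁.interval_snd'⟩).mirror hx hy
      (hs₁.mirror_disInv.2 ⟨hne, hxy', hxy⟩)
    obtain ⟨a₂, b₂, h₂, h₂'⟩ := exists_movesWithin_swap_rotation h₁.interval_fst'
      h₁.interval_snd' ⟨x, hx⟩
    obtain ⟨a₃, b₃, h₃, hr₃, hd₃⟩ := exists_movesWithin_reducedWithin ih _ a₂ b₂ h₂.interval_fst'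
      h₂.interval_snd' (h₂.same.symm.trans hs₁) rfl
    refine ⟨a₃, b₃, h₁.trans (h₂.trans h₃), fun u hu v hv => ?_⟩
    by_contra hc
    have hs₃ := (h₂.trans h₃).same.symm.trans hs₁
    have hne' : u ≠ v := by rintro rfl; simp at hc
    -- The last moves keep the first order on inversions, where a₁ already agrees with c. A
    -- remaining disagreement is thus a non-inversion on which a₁ agreed.
    have key : ∀ p ∈ I, ∀ q ∈ I, p ≠ q → ¬ (a₃ p < a₃ q ↔ c p < c q) →
        (a₁ p < a₁ q ↔ b₁ p < b₁ q) ∧ (a₁ p < a₁ q ↔ c p < c q) := by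
      intro p hp q hq hpq h
      have e4 := hd₃ p hp q hq h
      rw [h₂' p hp q hq, not_lt_iff_perm b₁ hpq] at e4
      have e5 : a₁ p < a₁ q ↔ b₁ p < b₁ q := by
        by_contra h5
        have h6 := hd₁ p hp q hq h5
        generalize (a₁ p < a₁ q) = A at *
        generalize (b₁ p < b₁ q) = B at *
        generalize (c p < c q) = C at *
        clear * - e4 h5 h6
        tauto
      have e6 : ¬ (¬ b₁ p < b₁ q ↔ c p < c q) → (b₁ p < b₁ q ↔ c p < c q) := by
        clear * -
        tauto
      exact ⟨e5, e5.trans (e6 e4)⟩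
    refine hA (((hr₃.toOrderPairs hs₃).mirror.connectedOn_disInv
      (hs₃.isBlock.2 ⟨h₃.interval_fst', h₃.interval_snd'⟩).mirror hu hv
      (hs₃.mirror_disInv.2 ⟨hne', ?_, hc⟩)).mono fun p hp q hq hpq => ?_)
    · have e5 := (h₂.trans h₃).same u v hne'
      exact e5.1 (key u hu v hv hne' hc).1
    · obtain ⟨e1, e2, e3⟩ := hs₃.mirror_disInv.1 hpq
      exact hs₁.mirror_agreeInv.2 ⟨e1, key p hp q hq e1 e3⟩

theorem perm_eq_of_lt_iff_lt (h : ∀ i j, a i < a j ↔ c i < c j) : a = c := by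
  let e : Fin n ≃o Fin n := ⟨a * c⁻¹, fun {i j} => by
    have := h (c⁻¹ j) (c⁻¹ i)
    have e : ∀ k, c (c⁻¹ k) = k := fun k => by simp
    rw [e, e] at this
    rw [← not_lt, ← not_lt]
    exact not_congr this⟩
  have h1 : e = OrderIso.refl (Fin n) := Subsingleton.elim _ _
  have h2 : a * c⁻¹ = 1 := by
    ext1 i
    exact congrArg (fun f : Fin n ≃o Fin n => f i) h1
  exact mul_inv_eq_one.1 h2

theorem SameInversions.pairEquivalent [NeZero n] (h : SameInversions a b c d) :
    PairEquivalent a b c d := by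
  obtain ⟨a', b', h', hm⟩ := canMatch c d _ Set.univ rfl a b (fun _ _ _ _ _ _ _ => trivial)
    (fun _ _ _ _ _ _ _ => trivial) h
  have ha : a' = c := perm_eq_of_lt_iff_lt fun i j => hm i trivial j trivial
  have hb : b' = d := perm_eq_of_lt_iff_lt fun i j => by
    by_cases hij : i = j
    · simp [hij]
    · have h1 := h'.same.symm.trans h i j hij
      have h2 := hm i trivial j trivial
      rw [h2] at h1
      clear * - h1
      tauto
  exact ha ▸ hb ▸ h'.equivalent

/-! ### From switching-equivalence to spindle-equivalence. -/

/-- Cutting a linear order at p and exchanging the two pieces reverses exactly the pairs separated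
by the cut, which is a switching. -/
theorem exists_sign_of_rotation [NeZero n] (a : Equiv.Perm (Fin n)) (p : Fin n) :
    ∃ ε : Fin n → ℝ, (∀ i, ε i ≠ 0) ∧ ∀ i j, i ≠ j →
      0 < ε i * ε j * (((a i : ℕ) : ℝ) - (a j : ℕ)) *
        ((((Equiv.addRight (-p) * a) i : ℕ) : ℝ) - ((Equiv.addRight (-p) * a) j : ℕ)) := by
  refine ⟨fun i => if (p : ℕ) ≤ a i then 1 else -1, fun i => by
    simp only; split_ifs <;> norm_num,
    fun i j hij => ?_⟩
  have hne : ((a i : ℕ) : ℝ) - (a j : ℕ) ≠ 0 :=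
    sub_ne_zero.2 (Nat.cast_injective.ne (Fin.val_injective.ne (a.injective.ne hij)))
  have hsq := mul_self_pos.2 hne
  have hi : ((a i : ℕ) : ℝ) < n := by exact_mod_cast (a i).2
  have hj : ((a j : ℕ) : ℝ) < n := by exact_mod_cast (a j).2
  have hi0 : (0 : ℝ) ≤ (a i : ℕ) := Nat.cast_nonneg _
  have hj0 : (0 : ℝ) ≤ (a j : ℕ) := Nat.cast_nonneg _
  have hp := p.2
  rw [val_addRight_neg_mul, val_addRight_neg_mul]
  by_cases h1 : (p : ℕ) ≤ a i <;> by_cases h2 : (p : ℕ) ≤ a j <;>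
    simp only [h1, h2, if_true, if_false]
  · rw [Nat.cast_sub h1, Nat.cast_sub h2]
    exact lt_of_lt_of_eq hsq (by ring)
  · rw [Nat.cast_sub h1, Nat.cast_sub (by omega)]
    push_cast
    have h3 : ((a j : ℕ) : ℝ) < a i := by exact_mod_cast (by omega : (a j : ℕ) < a i)
    exact lt_of_lt_of_eq (mul_pos (sub_pos.2 h3)
      (by linarith : (0 : ℝ) < n + (a j : ℕ) - (a i : ℕ))) (by ring)
  · rw [Nat.cast_sub h2, Nat.cast_sub (by omega)]
    push_cast
    have h3 : ((a i : ℕ) : ℝ) < a j := by exact_mod_cast (by omega : (a i : ℕ) < a j)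
    exact lt_of_lt_of_eq (mul_pos (sub_pos.2 h3)
      (by linarith : (0 : ℝ) < n + (a i : ℕ) - (a j : ℕ))) (by ring)
  · rw [Nat.cast_sub (by omega), Nat.cast_sub (by omega)]
    push_cast
    exact lt_of_lt_of_eq hsq (by ring)

theorem mul_pos_of_signs {x y z w X Y Z W l l' e₁ e₁' e₂ e₂' e₃ e₃' e₄ e₄' : ℝ}
    (h : 0 < l * l' * (x * y) * (z * w)) (h₁ : 0 < e₁ * e₁' * x * X) (h₂ : 0 < e₂ * e₂' * y * Y)
    (h₃ : 0 < e₃ * e₃' * z * Z) (h₄ : 0 < e₄ * e₄' * w * W) :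
    0 < (l * e₁ * e₂ * e₃ * e₄) * (l' * e₁' * e₂' * e₃' * e₄') * (X * Y * (Z * W)) := by
  have h0 : 0 < (x * y * (z * w)) ^ 2 := by
    refine sq_pos_of_ne_zero fun h0 => ?_
    rw [mul_assoc, h0, mul_zero] at h
    exact lt_irrefl _ h
  exact pos_of_mul_pos_right
    (lt_of_lt_of_eq (mul_pos h (mul_pos (mul_pos h₁ h₂) (mul_pos h₃ h₄))) (by ring)) h0.le

/-- Switching-equivalent inversion signs can be made equal by circular moves. -/
theorem pairEquivalent_of_switching [NeZero n] {l : Fin n → ℝ} (hl : ∀ i, l i ≠ 0)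
    (h : ∀ i j, i ≠ j → 0 < l i * l j *
      ((((a i : ℕ) : ℝ) - (a j : ℕ)) * (((b i : ℕ) : ℝ) - (b j : ℕ))) *
      ((((c i : ℕ) : ℝ) - (c j : ℕ)) * (((d i : ℕ) : ℝ) - (d j : ℕ)))) :
    PairEquivalent a b c d := by
  -- Each of the four orders is rotated so that label 0 comes first.
  obtain ⟨ε₁, hε₁, h₁⟩ := exists_sign_of_rotation a (a 0)
  obtain ⟨ε₂, hε₂, h₂⟩ := exists_sign_of_rotation b (b 0)
  obtain ⟨ε₃, hε₃, h₃⟩ := exists_sign_of_rotation c (c 0)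
  obtain ⟨ε₄, hε₄, h₄⟩ := exists_sign_of_rotation d (d 0)
  set A := Equiv.addRight (-(a 0)) * a with hA
  set B := Equiv.addRight (-(b 0)) * b with hB
  set C := Equiv.addRight (-(c 0)) * c with hC
  set D := Equiv.addRight (-(d 0)) * d with hD
  have key : SameInversions A B C D := by
    set L : Fin n → ℝ := fun i => l i * ε₁ i * ε₂ i * ε₃ i * ε₄ i with hL
    set P : Fin n → Fin n → ℝ := fun i j =>
      (((A i : ℕ) : ℝ) - (A j : ℕ)) * (((B i : ℕ) : ℝ) - (B j : ℕ)) with hP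
    set Q : Fin n → Fin n → ℝ := fun i j =>
      (((C i : ℕ) : ℝ) - (C j : ℕ)) * (((D i : ℕ) : ℝ) - (D j : ℕ)) with hQ
    have hsw : ∀ i j, i ≠ j → 0 < L i * L j * (P i j * Q i j) := by
      intro i j hij
      exact mul_pos_of_signs (h i j hij) (h₁ i j hij) (h₂ i j hij) (h₃ i j hij) (h₄ i j hij)
    have h0 : ∀ (r : Equiv.Perm (Fin n)) (i : Fin n), i ≠ 0 →
        0 < (((Equiv.addRight (-(r 0)) * r) i : ℕ) : ℝ) - ((Equiv.addRight (-(r 0)) * r) 0 : ℕ) := by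
      intro r i hi
      have e1 : (Equiv.addRight (-(r 0)) * r) 0 = 0 := by simp
      have e2 : (Equiv.addRight (-(r 0)) * r) i ≠ 0 := fun e =>
        hi ((Equiv.addRight (-(r 0)) * r).injective (e.trans e1.symm))
      rw [e1]
      have e3 : 0 < ((Equiv.addRight (-(r 0)) * r) i : ℕ) := Fin.pos_iff_ne_zero.2 e2
      simpa using e3
    -- All four differences i minus 0 are positive, so every L i has the sign of L 0 and the
    -- switching is trivial.
    have hL0 : ∀ i, i ≠ 0 → 0 < L i * L 0 := fun i hi =>
      pos_of_mul_pos_left (hsw i 0 hi)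
        (mul_pos (mul_pos (h0 a i hi) (h0 b i hi)) (mul_pos (h0 c i hi) (h0 d i hi))).le
    have hLne : ∀ i, L i ≠ 0 := fun i => by
      simp only [hL]
      exact mul_ne_zero (mul_ne_zero (mul_ne_zero (mul_ne_zero (hl i) (hε₁ i)) (hε₂ i)) (hε₃ i))
        (hε₄ i)
    have hLpos : ∀ i j, 0 < L i * L j := by
      have h1 : ∀ i, 0 < L i * L 0 := fun i => by
        by_cases hi : i = 0
        · rw [hi]; exact mul_self_pos.2 (hLne 0)
        · exact hL0 i hi
      intro i j
      have := mul_pos (h1 i) (h1 j)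
      have h2 := mul_self_pos.2 (hLne 0)
      exact pos_of_mul_pos_left (b := L 0 * L 0) (lt_of_lt_of_eq this (by ring)) h2.le
    intro i j hij
    have hPQ : 0 < P i j * Q i j := pos_of_mul_pos_right (hsw i j hij) (hLpos i j).le
    have hsign : ∀ r s : Equiv.Perm (Fin n),
        0 < (((r i : ℕ) : ℝ) - (r j : ℕ)) * (((s i : ℕ) : ℝ) - (s j : ℕ)) ↔
          (r i < r j ↔ s i < s j) := by
      intro r s
      have e1 := not_lt_iff_perm r hij
      have e2 := not_lt_iff_perm s hij
      rw [mul_pos_iff, sub_pos, sub_pos, sub_neg, sub_neg]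
      simp only [Nat.cast_lt, Fin.val_fin_lt]
      tauto
    rw [← hsign A B, ← hsign C D]
    constructor
    · exact fun h5 => pos_of_mul_pos_right hPQ h5.le
    · exact fun h5 => pos_of_mul_pos_left hPQ h5.le
  exact (pairEquivalent_rotate a b _ _).trans
    (key.pairEquivalent.trans (pairEquivalent_rotate c d _ _).symm)

theorem spindleEquivalent_of_isotopic {σ σ' : Equiv.Perm (Fin n)}
    (h : Isotopic (permConfig 1 σ) (permConfig 1 σ')) : SpindleEquivalent σ σ' := by
  rcases Nat.eq_zero_or_pos n with rfl | hn
  · rw [Subsingleton.elim σ σ']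
    exact SpindleEquivalent.refl _
  · have : NeZero n := ⟨hn.ne'⟩
    obtain ⟨π, l, hl, hs⟩ := exists_switching_of_permConfig_isotopic h
    have := pairEquivalent_of_switching (a := 1) (b := σ) (c := π) (d := σ' * π) hl hs
    simpa [PairEquivalent] using this

end

theorem theorem1p1 (n : ℕ) :
    (∀ σ : Equiv.Perm (Fin n), ∃ C : SkewConfiguration n, IsSpindleWith C σ) ∧
    ∀ (σ σ' : Equiv.Perm (Fin n)) (C C' : SkewConfiguration n),
      IsSpindleConfigurationWith C σ → IsSpindleConfigurationWith C' σ' →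
        (Isotopic C C' ↔ SpindleEquivalent σ σ') := by
  refine ⟨fun σ => ⟨_, exists_isSpindleWith σ⟩, ?_⟩
  rintro σ σ' C C' ⟨S, hS, hCS⟩ ⟨S', hS', hCS'⟩
  have h := hCS.trans hS.isotopic
  have h' := hCS'.trans hS'.isotopic
  exact ⟨fun hC => spindleEquivalent_of_isotopic (h.symm.trans (hC.trans h')),
    fun he => h.trans (he.isotopic.trans h'.symm)⟩
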